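/- Let $k$ be a field, $Q$ a finite quiver and $\Lambda=kQ/\mathcal J$ a gentle algebra: $\mathcal J$ is an admissible ideal generated by paths of length $2$; each vertex is the head of at most two and the tail of at most two arrows; and for each arrow $y$ there is at most one arrow $x$ with $xy$ a path in $\mathcal J$, at most one with $xy$ a path not in $\mathcal J$, at most one arrow $z$ with $yz$ a path in $\mathcal J$, and at most one with $yz$ a path not in $\mathcal J$. (Here $ba$ means first $a$, then $b$; $h$ and $t$ denote head and tail.) Let $\mathbf P$ be the set of non-trivial paths not in $\mathcal J$; $\gamma\in\mathbf P$ has a first arrow $\mathrm f(\gamma)$ and a last arrow $\mathrm l(\gamma)$. Put $h(\alpha^{-1})=t(\alpha)$ for an arrow $\alpha$, and fix signs $s(\alpha^{\pm1})\in\{\pm1\}$ such that distinct symbols $l,l'$ of the form $\alpha$ or $\alpha^{-1}$ with the same head have the same sign if and only if $\{l,l'\}=\{\alpha^{-1},\beta\}$ with $\alpha\beta\in\mathcal J$. *Words.* A generalised letter is $[\gamma]$ or $[\gamma^{-1}]$ with $\gamma\in\mathbf P$; $h([\gamma])=t(\gamma)=t([\gamma^{-1}])$, $t([\gamma])=h(\gamma)=h([\gamma^{-1}])$,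 $s([\gamma])=s(\mathrm f(\gamma)^{-1})$, $s([\gamma^{-1}])=-s(\mathrm l(\gamma))$. In a generalised word consecutive letters must be $[\gamma][\lambda^{-1}]$ with $h(\gamma)=h(\lambda)$, $\mathrm l(\gamma)\ne\mathrm l(\lambda)$; $[\gamma^{-1}][\lambda^{-1}]$ with $t(\gamma)=h(\lambda)$, $\mathrm f(\gamma)\mathrm l(\lambda)\in\mathcal J$; $[\gamma^{-1}][\lambda]$ with $t(\gamma)=t(\lambda)$, $\mathrm f(\gamma)\neq\mathrm f(\lambda)$; or $[\gamma][\lambda]$ with $h(\gamma)=t(\lambda)$, $\mathrm f(\lambda)\mathrm l(\gamma)\in\mathcal J$. There are also trivial words $1_{v,\pm1}$ for each vertex $v$, with $1_{v,\delta}^{-1}=1_{v,-\delta}$, head $v$ and sign $\delta$; head and sign of a non-trivial word are those of its first letter, and words $D$, $E$ compose to a word $DE$ if and only if $h(D^{-1})=h(E)$ and $s(D^{-1})=-s(E)$. Let $C=l_1^{-1}r_1\cdots l_t^{-1}r_t$ be a finite homotopy word of head $v$ and sign $\delta$: each $l_i^{-1}r_i$ is $\gamma^{-1}d_{\mathrm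 l(\gamma)}$ or $d_{\mathrm l(\gamma)}^{-1}\gamma$ with $\gamma\in\mathbf P$, and replacing these pairs by $[\gamma]$ or $[\gamma^{-1}]$ respectively gives a generalised word $[C]$ (for $t=0$, $C=1_{v,\delta}$). Let $C(\searrow)$ be obtained from $C$ by appending the longest possible (perhaps empty or infinite) sequence $[\gamma_1^{-1}][\gamma_2^{-1}]\cdots$ with all $\gamma_i$ arrows, and let $C(\swarrow\searrow)$ be obtained from $C(\searrow)$ by prepending the longest possible sequence $\cdots[\alpha_2][\alpha_1]$ with all $\alpha_i$ arrows. Index the places of $C(\swarrow\searrow)$ by an interval $I\subseteq\mathbb Z$ such that the place $0$ is where $C$ begins and $[C_i]$ lies between the places $i-1$ and $i$; let $v(i)$ be the vertex at the place $i$ (so $v(i-1)=h([C_i])$, $v(i)=t([C_i])$, $v(0)=v$). *Complexes.* $P=P(C(\swarrow\searrow))$ is the complex with $P^n=\bigoplus_{\mu(i)=n}\Lambda e_{v(i)}$, with $b_i$ the copy of $e_{v(i)}$, where $\mu(0)=0$ and $\mu(i)-\mu(i-1)$ is $-1$ if $[C_i]=[\gamma]$ and $1$ if $[C_i]=[\gamma^{-1}]$;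 its differential is $b_i\mapsto b_i^-+b_i^+$, where $b_i^+=\alpha b_{i+1}$ if $[C_{i+1}]=[\alpha^{-1}]$ and $b_i^-=\beta b_{i-1}$ if $[C_i]=[\beta]$, and these are $0$ otherwise. Let $E=1_{v,\delta}(\swarrow\searrow)$. The compact morphism $a\langle C\rangle:P(E)\to P(C(\swarrow\searrow))$ is the identity if $E=C(\swarrow\searrow)$. Otherwise $C(\searrow)=B\,l^{-1}r\,D$ where $B$ consists of $q\ge0$ pairs of the form $d_\alpha^{-1}\alpha$ with $\alpha$ an arrow and $l^{-1}r$ is not of this form; then $b_i\mapsto b_i$ for $i\le q$; $b_{q+1}\mapsto\lambda b_{q+1}$ if $l^{-1}r=d_{\mathrm l(\gamma)}^{-1}\gamma$ with $\gamma=\mathrm l(\gamma)\lambda$; and all other $b_i\mapsto0$. *Subspaces.* Let $M$ be a homotopically minimal complex of projective left $\Lambda$-modules, that is, $\mathrm{im}(d_M^n)\subseteq\mathrm{rad}(M^{n+1})$ for all $n$. Also write $M$ for $\bigoplus_iM^i$ and $d_M$ for its differential. For an arrow $\alpha$ let $d_{\alpha,M}:e_{h(\alpha)}M\to e_{h(\alpha)}M$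 be given by $d_{\alpha,M}(m)=\alpha m_\alpha$, where $d_M(m)=\sum_\beta\beta m_\beta$ over the arrows $\beta$ with head $h(\alpha)$ (this is well defined). Let $CM$ be the set of all $m\in e_vM$ for which there are $m=m_0,m_1,\dots,m_t$ with $m_i\in e_{v(i)}M$ and, for $1\le i\le t$, $\gamma m_{i-1}=d_{\mathrm l(\gamma),M}(m_i)$ if $l_i^{-1}r_i=\gamma^{-1}d_{\mathrm l(\gamma)}$ and $d_{\mathrm l(\gamma),M}(m_{i-1})=\gamma m_i$ if $l_i^{-1}r_i=d_{\mathrm l(\gamma)}^{-1}\gamma$. *Claim.* Let $r\in\mathbb Z$, let $[r]$ be the shift moving degree $0$ to degree $r$, and let $a=a\langle C\rangle[r]:P(E)[r]\to P(C(\swarrow\searrow))[r]$. Let $Ma$ be the set of morphisms of complexes $P(E)[r]\to M$ of the form $fa$, where $f:P(C(\swarrow\searrow))[r]\to M$ is a morphism of complexes. Then $$e_vM^r\cap CM=\{g(b_0)\mid g\in Ma\},$$ where $b_0\in P(E)[r]$ is the basis element of degree $r$ at the place $0$. Moreover the set of homotopy classes of the elements of $Ma$ is the pp-definable subgroup of $M$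 given by (the class of) $a$, namely the set of all morphisms in the homotopy category of the form $\phi a$ with $\phi:P(C(\swarrow\searrow))[r]\to M$. -/

import Mathlib

open CategoryTheory
open scoped DirectSum

universe u

noncomputable section

/-! ### Quivers with relations, path algebras, gentle algebras -/

/-- A quiver with vertices `V`, arrows `A`, head and tail maps `hd`, `tl`, together with a set
`rel` of paths of length `2`: the pair `(x, y)` stands for the path `x y` (first `y`, then `x`). -/
structure QuiverRel (V A : Type u) where
  hd : A → V
  tl : A → V
  rel : Set (A × A)
  rel_path : ∀ p ∈ rel, tl p.1 = hd p.2

namespace QuiverRel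

variable {V A : Type u} (Q : QuiverRel V A) (k : Type u) [Field k] [Fintype V]

/-- The defining relations of the path algebra on the generators `e_v` (`v` a vertex) and `a`
(`a` an arrow); `b * a` is the path "first `a`, then `b`". -/
inductive PathRel : FreeAlgebra k (V ⊕ A) → FreeAlgebra k (V ⊕ A) → Prop
  | idem (v : V) : PathRel (FreeAlgebra.ι k (Sum.inl v) * FreeAlgebra.ι k (Sum.inl v))
      (FreeAlgebra.ι k (Sum.inl v))
  | orth (v w : V) (hvw : v ≠ w) :
      PathRel (FreeAlgebra.ι k (Sum.inl v) * FreeAlgebra.ι k (Sum.inl w)) 0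
  | unit : PathRel (∑ v : V, FreeAlgebra.ι k (Sum.inl v)) 1
  | head (a : A) : PathRel (FreeAlgebra.ι k (Sum.inl (Q.hd a)) * FreeAlgebra.ι k (Sum.inr a))
      (FreeAlgebra.ι k (Sum.inr a))
  | tail (a : A) : PathRel (FreeAlgebra.ι k (Sum.inr a) * FreeAlgebra.ι k (Sum.inl (Q.tl a)))
      (FreeAlgebra.ι k (Sum.inr a))

/-- The path algebra `kQ`, by generators and relations. -/
abbrev PathAlgebra : Type u := RingQuot (Q.PathRel k)

/-- The trivial path `e_v` in `kQ`. -/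
def triv (v : V) : Q.PathAlgebra k :=
  RingQuot.mkAlgHom k (Q.PathRel k) (FreeAlgebra.ι k (Sum.inl v))

/-- The arrow `a` in `kQ`. -/
def arrow (a : A) : Q.PathAlgebra k :=
  RingQuot.mkAlgHom k (Q.PathRel k) (FreeAlgebra.ι k (Sum.inr a))

/-- The product `x₁ ⋯ xₘ` in `kQ` of a list of arrows. -/
def pathProd (p : List A) : Q.PathAlgebra k := (p.map (Q.arrow k)).prod

/-- The list of arrows `x₁, …, xₘ` is a path `x₁ ⋯ xₘ`: the tail of `xᵢ` is the head of `xᵢ₊₁`. -/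
def IsPath (p : List A) : Prop := p.IsChain (fun x y => Q.tl x = Q.hd y)

/-- The two-sided ideal `𝓙` of `kQ` generated by the given paths of length `2`. -/
def ideal : TwoSidedIdeal (Q.PathAlgebra k) :=
  TwoSidedIdeal.span {z | ∃ p ∈ Q.rel, z = Q.arrow k p.1 * Q.arrow k p.2}

/-- `kQ/𝓙` is a gentle algebra. As `𝓙` is generated by paths of length `2` it is contained in the
square of the arrow ideal, so that admissibility says that all long enough paths lie in `𝓙`. -/
structure IsGentle : Prop where
  admissible : ∃ N : ℕ, 2 ≤ N ∧
    ∀ p : List A, Q.IsPath p → p.length = N → Q.pathProd k p ∈ Q.ideal k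
  out_le : ∀ v : V, {a : A | Q.tl a = v}.encard ≤ 2
  in_le : ∀ v : V, {a : A | Q.hd a = v}.encard ≤ 2
  left_mem : ∀ y : A, {x : A | Q.tl x = Q.hd y ∧ Q.arrow k x * Q.arrow k y ∈ Q.ideal k}.encard ≤ 1
  right_mem : ∀ y : A, {z : A | Q.hd z = Q.tl y ∧ Q.arrow k y * Q.arrow k z ∈ Q.ideal k}.encard ≤ 1
  left_not_mem : ∀ y : A,
    {x : A | Q.tl x = Q.hd y ∧ Q.arrow k x * Q.arrow k y ∉ Q.ideal k}.encard ≤ 1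
  right_not_mem : ∀ y : A,
    {z : A | Q.hd z = Q.tl y ∧ Q.arrow k y * Q.arrow k z ∉ Q.ideal k}.encard ≤ 1

/-- The head of a symbol `α` (`Sum.inl α`) or `α⁻¹` (`Sum.inr α`). -/
def symHd : A ⊕ A → V
  | Sum.inl a => Q.hd a
  | Sum.inr a => Q.tl a

/-- A choice of signs for the symbols `α`, `α⁻¹`: distinct symbols with the same head have the same
sign if and only if they are `α⁻¹` and `β` with `α β ∈ 𝓙`. -/
def IsSign (s : A ⊕ A → ℤˣ) : Prop :=
  ∀ l l' : A ⊕ A, l ≠ l' → Q.symHd l = Q.symHd l' →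
    (s l = s l' ↔ ∃ α β : A, Q.arrow k α * Q.arrow k β ∈ Q.ideal k ∧
      ((l = Sum.inr α ∧ l' = Sum.inl β) ∨ (l = Sum.inl β ∧ l' = Sum.inr α)))

end QuiverRel

/-- A gentle algebra `kQ/𝓙` (with `Q` a finite quiver), and a choice of signs. -/
structure GentleData (k V A : Type u) [Field k] [Fintype V] [Fintype A] where
  Q : QuiverRel V A
  gentle : Q.IsGentle k
  sign : A ⊕ A → ℤˣ
  isSign : Q.IsSign k sign

namespace GentleData

variable {k V A : Type u} [Field k] [Fintype V] [Fintype A] (G : GentleData k V A)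

/-- The gentle algebra `Λ = kQ/𝓙`. -/
abbrev Alg : Type u := (G.Q.ideal k).ringCon.Quotient

/-- The quotient map `kQ → Λ`. -/
def proj : G.Q.PathAlgebra k →+* G.Alg := (G.Q.ideal k).ringCon.mk'

/-- `e_v` in `Λ`. -/
def e (v : V) : G.Alg := G.proj (G.Q.triv k v)

/-- The coset of an arrow in `Λ`. -/
def ar (a : A) : G.Alg := G.proj (G.Q.arrow k a)

/-- The coset of the product of a list of arrows in `Λ`. -/
def word (p : List A) : G.Alg := G.proj (G.Q.pathProd k p)

/-- The set `𝐏` of non-trivial paths which do not lie in `𝓙`. -/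
structure NzPath where
  arrows : List A
  ne_nil : arrows ≠ []
  isPath : G.Q.IsPath arrows
  not_mem : G.Q.pathProd k arrows ∉ G.Q.ideal k

namespace NzPath

variable {G}

/-- The last arrow `l(γ)`. -/
def last (γ : G.NzPath) : A := γ.arrows.head γ.ne_nil

/-- The first arrow `f(γ)`. -/
def first (γ : G.NzPath) : A := γ.arrows.getLast γ.ne_nil

/-- The head `h(γ)`. -/
def hd (γ : G.NzPath) : V := G.Q.hd γ.last

/-- The tail `t(γ)`. -/
def tl (γ : G.NzPath) : V := G.Q.tl γ.first

/-- The element of `Λ` given by `γ`. -/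
def val (γ : G.NzPath) : G.Alg := G.word γ.arrows

/-- The element of `Λ` given by `λ`, where `γ = l(γ) λ`. -/
def rest (γ : G.NzPath) : G.Alg := G.word γ.arrows.tail

/-- `γ` is an arrow. -/
def IsArrow (γ : G.NzPath) : Prop := γ.arrows.length = 1

end NzPath

/-! ### Letters and words -/

/-- The generalised letters: `dir γ` is `[γ]` and `inv γ` is `[γ⁻¹]`. In the language of homotopy
words `dir γ` is the pair of homotopy letters `l⁻¹ r = γ⁻¹ d_{l(γ)}`, and `inv γ` is the pair
`l⁻¹ r = d_{l(γ)}⁻¹ γ`. -/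
inductive Letter
  | dir (γ : G.NzPath)
  | inv (γ : G.NzPath)

namespace Letter

variable {G}

/-- Head of a letter: `h([γ]) = t(γ)` and `h([γ⁻¹]) = h(γ)`. -/
def hd : G.Letter → V
  | dir γ => γ.tl
  | inv γ => γ.hd

/-- Tail of a letter: `t([γ]) = h(γ)` and `t([γ⁻¹]) = t(γ)`. -/
def tl : G.Letter → V
  | dir γ => γ.hd
  | inv γ => γ.tl

/-- The inverse letter. -/
def flip : G.Letter → G.Letter
  | dir γ => inv γ
  | inv γ => dir γ

/-- `s([γ]) = s(f(γ)⁻¹)` and `s([γ⁻¹]) = -s(l(γ))`. -/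
def sgn : G.Letter → ℤˣ
  | dir γ => G.sign (Sum.inr γ.first)
  | inv γ => - G.sign (Sum.inl γ.last)

/-- `H[γ] = -1` and `H[γ⁻¹] = 1`. -/
def deg : G.Letter → ℤ
  | dir _ => -1
  | inv _ => 1

/-- `[C_i][C_{i+1}]` may occur in a generalised word. -/
def Adj : G.Letter → G.Letter → Prop
  | dir γ, inv μ => γ.hd = μ.hd ∧ γ.last ≠ μ.last
  | inv γ, inv μ => γ.tl = μ.hd ∧ G.Q.arrow k γ.first * G.Q.arrow k μ.last ∈ G.Q.ideal k
  | inv γ, dir μ => γ.tl = μ.tl ∧ γ.first ≠ μ.first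
  | dir γ, dir μ => γ.hd = μ.tl ∧ G.Q.arrow k μ.first * G.Q.arrow k γ.last ∈ G.Q.ideal k

/-- The letter is `[α]` for an arrow `α`. -/
def IsDirArrow : G.Letter → Prop
  | dir γ => γ.IsArrow
  | inv _ => False

/-- The letter is `[α⁻¹]` for an arrow `α` (that is, the pair `d_α⁻¹ α`). -/
def IsInvArrow : G.Letter → Prop
  | dir _ => False
  | inv γ => γ.IsArrow

theorem neg_units_iff {a b : ℤˣ} : a = -b ↔ a ≠ b := by
  rcases Int.units_eq_one_or a with rfl | rfl <;> rcases Int.units_eq_one_or b with rfl | rfl <;>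
    decide

theorem sign_hd_eq {a b : A} (h : G.Q.hd a = G.Q.hd b)
    (hs : G.sign (Sum.inl a) = G.sign (Sum.inl b)) : a = b := by
  by_contra hab
  obtain ⟨α, β, -, h1 | h1⟩ := (G.isSign (Sum.inl a) (Sum.inl b) (by simpa using hab) h).1 hs
  · exact absurd h1.1 (by simp)
  · exact absurd h1.2 (by simp)

theorem sign_tl_eq {a b : A} (h : G.Q.tl a = G.Q.tl b)
    (hs : G.sign (Sum.inr a) = G.sign (Sum.inr b)) : a = b := by
  by_contra hab
  obtain ⟨α, β, -, h1 | h1⟩ := (G.isSign (Sum.inr a) (Sum.inr b) (by simpa using hab) h).1 hs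
  · exact absurd h1.2 (by simp)
  · exact absurd h1.1 (by simp)

theorem sign_mixed {a b : A} (h : G.Q.tl a = G.Q.hd b) :
    G.sign (Sum.inr a) = G.sign (Sum.inl b) ↔ G.Q.arrow k a * G.Q.arrow k b ∈ G.Q.ideal k := by
  rw [G.isSign (Sum.inr a) (Sum.inl b) (by simp) h]
  constructor
  · rintro ⟨α, β, hm, ⟨h1, h2⟩ | ⟨h1, h2⟩⟩
    · cases h1; cases h2; exact hm
    · exact absurd h1 (by simp)
  · intro hm
    exact ⟨a, b, hm, Or.inl ⟨rfl, rfl⟩⟩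

/-- The composition of words is a word if and only if heads agree and signs are opposite. -/
theorem adj_iff (x y : G.Letter) : x.Adj y ↔ x.tl = y.hd ∧ y.sgn = - x.flip.sgn := by
  rcases x with γ | γ <;> rcases y with μ | μ
  · refine and_congr_right fun h => ?_
    simp only [flip, sgn, neg_neg]
    exact (sign_mixed (G := G) (a := μ.first) (b := γ.last) h.symm).symm
  · refine and_congr_right fun h => ?_
    simp only [flip, sgn, neg_neg]
    rw [← not_iff_not, not_not, neg_eq_iff_eq_neg, neg_units_iff, not_not]
    exact ⟨fun h' => by rw [h'], fun h' => (sign_hd_eq h.symm h').symm⟩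
  · refine and_congr_right fun h => ?_
    simp only [flip, sgn]
    rw [← not_iff_not, not_not, neg_units_iff, not_not]
    exact ⟨fun h' => by rw [h'], fun h' => (sign_tl_eq h.symm h').symm⟩
  · refine and_congr_right fun h => ?_
    simp only [flip, sgn, neg_inj]
    rw [eq_comm]
    exact (sign_mixed (G := G) (a := γ.first) (b := μ.last) h).symm

theorem Adj.tl_eq {x y : G.Letter} (h : x.Adj y) : x.tl = y.hd := ((adj_iff x y).1 h).1

end Letter

/-- The homotopy `{0, …, t}`-words with head `v` and sign `δ`, given by the list of their `t` pairs
of homotopy letters `lᵢ⁻¹ rᵢ`. The empty list is the trivial word `1_{v,δ}`. -/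
structure FinWord (v : V) (δ : ℤˣ) where
  letters : List G.Letter
  chain : letters.IsChain Letter.Adj
  start : ∀ x ∈ letters.head?, x.hd = v ∧ x.sgn = δ

/-- The trivial word `1_{v,δ}`. -/
def trivWord (v : V) (δ : ℤˣ) : G.FinWord v δ := ⟨[], List.isChain_nil, by simp⟩

/-- A generalised word, recorded with a base point: `letter i` is `[C_i]` and sits between the
places `i - 1` and `i`, the index set `I` is an interval of `ℤ` which contains the place `0`, and
`base` is the vertex at the place `0`. -/
structure GWord where
  base : V
  letter : ℤ → Option G.Letter
  adj : ∀ i x y, letter i = some x → letter (i + 1) = some y → x.Adj y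
  right_closed : ∀ i, 0 < i → letter i = none → letter (i + 1) = none
  left_closed : ∀ i, i ≤ 0 → letter i = none → letter (i - 1) = none
  base_hd : ∀ x, letter 1 = some x → x.hd = base
  base_tl : ∀ x, letter 0 = some x → x.tl = base

namespace GWord

variable {G} (C : G.GWord)

/-- The index set `I` of the word. -/
def index : Set ℤ := {i | (0 < i → (C.letter i).isSome) ∧ (i < 0 → (C.letter (i + 1)).isSome)}

/-- The vertex `v_C(i)` at the place `i ∈ I`. -/
def vert (i : ℤ) : V :=
  if 0 < i then ((C.letter i).map Letter.tl).getD C.base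
  else if i < 0 then ((C.letter (i + 1)).map Letter.hd).getD C.base
  else C.base

/-- `H[C_i]` (and `0` if there is no letter at `i`). -/
def letterDeg (i : ℤ) : ℤ := ((C.letter i).map Letter.deg).getD 0

/-- The degree function: `μ(0) = 0`, `μ(i) = H[C₁] + ⋯ + H[C_i]` for `i > 0` and
`μ(i) = -(H[C₀] + ⋯ + H[C_{i+1}])` for `i < 0`. -/
def mu (i : ℤ) : ℤ := ∑ j ∈ Finset.Ioc 0 i, C.letterDeg j - ∑ j ∈ Finset.Ioc i 0, C.letterDeg j

theorem mu_zero : C.mu 0 = 0 := by simp [mu]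

theorem mu_add_one (i : ℤ) : C.mu (i + 1) = C.mu i + C.letterDeg (i + 1) := by
  unfold mu
  rcases lt_or_ge i 0 with h | h
  · have h1 : Finset.Ioc 0 (i + 1) = ∅ := Finset.Ioc_eq_empty (by lia)
    have h2 : Finset.Ioc 0 i = ∅ := Finset.Ioc_eq_empty (by lia)
    have h3 : Finset.Ioc i 0 = insert (i + 1) (Finset.Ioc (i + 1) 0) := by
      ext j; simp only [Finset.mem_insert, Finset.mem_Ioc]; lia
    rw [h1, h2, h3, Finset.sum_insert (by simp)]
    simp
  · have h1 : Finset.Ioc (i + 1) 0 = ∅ := Finset.Ioc_eq_empty (by lia)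
    have h2 : Finset.Ioc i 0 = ∅ := Finset.Ioc_eq_empty (by lia)
    have h3 : Finset.Ioc 0 (i + 1) = insert (i + 1) (Finset.Ioc 0 i) := by
      ext j; simp only [Finset.mem_insert, Finset.mem_Ioc]; lia
    rw [h1, h2, h3, Finset.sum_insert (by simp)]
    simp [add_comm]

theorem isSome_of_le {i : ℤ} {x : G.Letter} (hx : C.letter i = some x) :
    ∀ j, i ≤ j → j ≤ 0 → ∃ y, C.letter j = some y := by
  intro j hij
  induction j, hij using Int.leInduction with
  | base => exact fun _ => ⟨x, hx⟩
  | succ n hn ih =>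
    intro h0
    obtain ⟨y, hy⟩ := ih (by lia)
    rcases hz : C.letter (n + 1) with _ | z
    · have := C.left_closed (n + 1) h0 hz
      simp [hy] at this
    · exact ⟨z, rfl⟩

theorem vert_of_letter {i : ℤ} {x : G.Letter} (hx : C.letter i = some x) :
    C.vert i = x.tl ∧ C.vert (i - 1) = x.hd ∧ i ∈ C.index ∧ i - 1 ∈ C.index := by
  refine ⟨?_, ?_, ⟨?_, ?_⟩, ⟨?_, ?_⟩⟩
  · rcases lt_trichotomy 0 i with h | h | h
    · simp [vert, h, hx]
    · subst h; simp [vert, C.base_tl x hx]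
    · obtain ⟨y, hy⟩ := C.isSome_of_le hx (i + 1) (by lia) (by lia)
      simp [vert, h, h.not_gt, hy, (C.adj i x y hx hy).tl_eq]
  · rcases lt_trichotomy 1 i with h | h | h
    · rcases hy : C.letter (i - 1) with _ | y
      · have := C.right_closed (i - 1) (by lia) hy
        simp [hx] at this
      · have := (C.adj (i - 1) y x hy (by simpa using hx)).tl_eq
        simp [vert, h, hy, this]
    · subst h; simp [vert, C.base_hd x hx]
    · simp [vert, show ¬ (1 < i) by lia, show i - 1 < 0 by lia, hx]
  · simp [hx]
  · intro h
    obtain ⟨y, hy⟩ := C.isSome_of_le hx (i + 1) (by lia) (by lia)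
    simp [hy]
  · intro h
    rcases hy : C.letter (i - 1) with _ | y
    · have := C.right_closed (i - 1) (by lia) hy
      simp [hx] at this
    · rfl
  · simp [hx]

/-! ### The complex of a word -/

/-- The basis element `b_i`, in the free `Λ`-module on the integers. -/
def b (i : ℤ) : ℤ →₀ G.Alg := Finsupp.single i (G.e (C.vert i))

/-- The degree `n` part `P^n(C) = ⊕ Λ b_i ≅ ⊕ Λ e_{v(i)}`, the sum over all `i ∈ I` with
`μ(i) = n`. -/
def piece (n : ℤ) : Submodule G.Alg (ℤ →₀ G.Alg) :=
  Submodule.span G.Alg {x | ∃ i ∈ C.index, C.mu i = n ∧ x = C.b i}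

/-- `b_i^+`. -/
def bPlus (i : ℤ) : ℤ →₀ G.Alg :=
  match C.letter (i + 1) with
  | some (Letter.inv α) => α.val • C.b (i + 1)
  | _ => 0

/-- `b_i^-`. -/
def bMinus (i : ℤ) : ℤ →₀ G.Alg :=
  match C.letter i with
  | some (Letter.dir β) => β.val • C.b (i - 1)
  | _ => 0

/-- The `Λ`-linear map with `b_i ↦ b_i^- + b_i^+`. -/
def diff : (ℤ →₀ G.Alg) →ₗ[G.Alg] (ℤ →₀ G.Alg) :=
  Finsupp.linearCombination G.Alg (fun i => C.bMinus i + C.bPlus i)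

end GWord

theorem triv_idem (v : V) : G.e v * G.e v = G.e v := by
  unfold e
  rw [← map_mul]
  congr 1
  unfold QuiverRel.triv
  rw [← map_mul]
  exact RingQuot.mkAlgHom_rel k (QuiverRel.PathRel.idem v)

theorem e_mul_ar (a : A) : G.e (G.Q.hd a) * G.ar a = G.ar a := by
  unfold e ar
  rw [← map_mul]
  congr 1
  unfold QuiverRel.triv QuiverRel.arrow
  rw [← map_mul]
  exact RingQuot.mkAlgHom_rel k (QuiverRel.PathRel.head a)

theorem word_cons (a : A) (p : List A) : G.word (a :: p) = G.ar a * G.word p := by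
  simp [word, ar, QuiverRel.pathProd]

theorem word_append (p q : List A) : G.word (p ++ q) = G.word p * G.word q := by
  simp [word, QuiverRel.pathProd]

theorem proj_eq_zero {z : G.Q.PathAlgebra k} (h : z ∈ G.Q.ideal k) : G.proj z = 0 := by
  have h1 : (G.Q.ideal k).ringCon z 0 := (TwoSidedIdeal.mem_iff _ _).1 h
  have h2 : G.proj z = G.proj 0 := (RingCon.eq _).2 h1
  simpa using h2

theorem ar_mul_ar {a c : A} (h : G.Q.arrow k a * G.Q.arrow k c ∈ G.Q.ideal k) :
    G.ar a * G.ar c = 0 := by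
  have := G.proj_eq_zero h
  rwa [map_mul] at this

theorem NzPath.val_eq (γ : G.NzPath) : γ.val = G.ar γ.last * γ.rest := by
  rcases γ with ⟨_ | ⟨a, p⟩, hne, hp, hn⟩
  · exact absurd rfl hne
  · exact G.word_cons a p

theorem NzPath.e_mul_val (γ : G.NzPath) : G.e γ.hd * γ.val = γ.val := by
  rw [NzPath.val_eq, ← mul_assoc]
  exact congrArg (· * γ.rest) (G.e_mul_ar γ.last)

theorem word_mul_eq_zero {p : List A} (hp : p ≠ []) {γ : G.NzPath}
    (h : G.Q.arrow k (p.getLast hp) * G.Q.arrow k γ.last ∈ G.Q.ideal k) :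
    G.word p * γ.val = 0 := by
  conv_lhs => rw [← List.dropLast_append_getLast hp, word_append, NzPath.val_eq, word_cons]
  have h0 : G.ar (p.getLast hp) * G.ar γ.last = 0 := G.ar_mul_ar h
  have h1 : G.word ([] : List A) = 1 := by simp [word, QuiverRel.pathProd]
  rw [h1, mul_one, mul_assoc, ← mul_assoc (G.ar _) (G.ar _), h0]
  simp

namespace GWord

variable {G} (C : G.GWord)

theorem bPlus_of {i : ℤ} {α : G.NzPath} (h : C.letter (i + 1) = some (Letter.inv α)) :
    C.bPlus i = α.val • C.b (i + 1) := by simp [bPlus, h]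

theorem bMinus_of {i : ℤ} {β : G.NzPath} (h : C.letter i = some (Letter.dir β)) :
    C.bMinus i = β.val • C.b (i - 1) := by simp [bMinus, h]

theorem bPlus_of_not {i : ℤ} (h : ∀ α, C.letter (i + 1) ≠ some (Letter.inv α)) :
    C.bPlus i = 0 := by
  unfold bPlus
  split
  · exact absurd ‹_› (h _)
  · rfl

theorem bMinus_of_not {i : ℤ} (h : ∀ β, C.letter i ≠ some (Letter.dir β)) :
    C.bMinus i = 0 := by
  unfold bMinus
  split
  · exact absurd ‹_› (h _)
  · rfl

theorem e_smul_bPlus (i : ℤ) : G.e (C.vert i) • C.bPlus i = C.bPlus i := by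
  by_cases h : ∃ α, C.letter (i + 1) = some (Letter.inv α)
  · obtain ⟨α, h⟩ := h
    have h1 := (C.vert_of_letter h).2.1
    rw [add_sub_cancel_right] at h1
    rw [C.bPlus_of h, h1, smul_smul]
    exact congrArg (· • C.b (i + 1)) α.e_mul_val
  · rw [C.bPlus_of_not (by simpa using h), smul_zero]

theorem e_smul_bMinus (i : ℤ) : G.e (C.vert i) • C.bMinus i = C.bMinus i := by
  by_cases h : ∃ α, C.letter i = some (Letter.dir α)
  · obtain ⟨α, h⟩ := h
    have h1 := (C.vert_of_letter h).1
    rw [C.bMinus_of h, h1, smul_smul]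
    exact congrArg (· • C.b (i - 1)) α.e_mul_val
  · rw [C.bMinus_of_not (by simpa using h), smul_zero]

theorem diff_b (i : ℤ) : C.diff (C.b i) = C.bMinus i + C.bPlus i := by
  simp only [diff, b, Finsupp.linearCombination_single, smul_add, e_smul_bPlus, e_smul_bMinus]

theorem b_mem {i n : ℤ} (hi : i ∈ C.index) (hn : C.mu i = n) : C.b i ∈ C.piece n :=
  Submodule.subset_span ⟨i, hi, hn, rfl⟩

theorem diff_b_mem {i n m : ℤ} (hn : C.mu i = n) (hm : n + 1 = m) :
    C.diff (C.b i) ∈ C.piece m := by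
  rw [diff_b]
  refine Submodule.add_mem _ ?_ ?_
  · by_cases h : ∃ α, C.letter i = some (Letter.dir α)
    · obtain ⟨α, h⟩ := h
      rw [C.bMinus_of h]
      refine Submodule.smul_mem _ _ (C.b_mem (C.vert_of_letter h).2.2.2 ?_)
      have h1 := C.mu_add_one (i - 1)
      rw [sub_add_cancel] at h1
      simp only [letterDeg, h, Option.map_some, Option.getD_some, Letter.deg] at h1
      lia
    · rw [C.bMinus_of_not (by simpa using h)]; exact Submodule.zero_mem _
  · by_cases h : ∃ α, C.letter (i + 1) = some (Letter.inv α)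
    · obtain ⟨α, h⟩ := h
      rw [C.bPlus_of h]
      refine Submodule.smul_mem _ _ (C.b_mem (C.vert_of_letter h).2.2.1 ?_)
      have h1 := C.mu_add_one i
      simp only [letterDeg, h, Option.map_some, Option.getD_some, Letter.deg] at h1
      lia
    · rw [C.bPlus_of_not (by simpa using h)]; exact Submodule.zero_mem _

theorem diff_mem {n m : ℤ} (hm : n + 1 = m) : ∀ x ∈ C.piece n, C.diff x ∈ C.piece m := by
  intro x hx
  have : C.piece n ≤ (C.piece m).comap C.diff := by
    refine Submodule.span_le.2 ?_
    rintro _ ⟨i, -, hn, rfl⟩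
    exact C.diff_b_mem hn hm
  exact this hx

theorem diff_diff_b (i : ℤ) : C.diff (C.diff (C.b i)) = 0 := by
  rw [diff_b, map_add]
  have h1 : C.diff (C.bMinus i) = 0 := by
    by_cases h : ∃ α, C.letter i = some (Letter.dir α)
    · obtain ⟨α, h⟩ := h
      rw [C.bMinus_of h, map_smul, diff_b, C.bPlus_of_not (by simp [h]), add_zero]
      by_cases h' : ∃ β, C.letter (i - 1) = some (Letter.dir β)
      · obtain ⟨β, h'⟩ := h'
        have hadj := C.adj (i - 1) _ _ h' (by simpa using h)
        rw [C.bMinus_of h', smul_smul]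
        have : α.val * β.val = 0 := G.word_mul_eq_zero α.ne_nil hadj.2
        rw [this, zero_smul]
      · rw [C.bMinus_of_not (by simpa using h'), smul_zero]
    · rw [C.bMinus_of_not (by simpa using h), map_zero]
  have h2 : C.diff (C.bPlus i) = 0 := by
    by_cases h : ∃ α, C.letter (i + 1) = some (Letter.inv α)
    · obtain ⟨α, h⟩ := h
      rw [C.bPlus_of h, map_smul, diff_b, C.bMinus_of_not (by simp [h]), zero_add]
      by_cases h' : ∃ β, C.letter (i + 1 + 1) = some (Letter.inv β)
      · obtain ⟨β, h'⟩ := h'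
        have hadj := C.adj (i + 1) _ _ h h'
        rw [C.bPlus_of h', smul_smul]
        have : α.val * β.val = 0 := G.word_mul_eq_zero α.ne_nil hadj.2
        rw [this, zero_smul]
      · rw [C.bPlus_of_not (by simpa using h'), smul_zero]
    · rw [C.bPlus_of_not (by simpa using h), map_zero]
  rw [h1, h2, add_zero]

theorem diff_diff {n : ℤ} : ∀ x ∈ C.piece n, C.diff (C.diff x) = 0 := by
  intro x hx
  have : C.piece n ≤ LinearMap.ker (C.diff ∘ₗ C.diff) := by
    refine Submodule.span_le.2 ?_
    rintro _ ⟨i, -, hn, rfl⟩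
    exact C.diff_diff_b i
  exact this hx

open Classical in
/-- The complex `P(C)`. -/
def complex : CochainComplex (ModuleCat.{u} G.Alg) ℤ where
  X n := ModuleCat.of G.Alg (C.piece n)
  d n m := if h : n + 1 = m then ModuleCat.ofHom (C.diff.restrict (C.diff_mem h)) else 0
  shape n m h := dif_neg h
  d_comp_d' n m l h h' := by
    have h1 : n + 1 = m := h
    have h2 : m + 1 = l := h'
    rw [dif_pos h1, dif_pos h2]
    refine ModuleCat.hom_ext (LinearMap.ext fun x => Subtype.ext ?_)
    exact C.diff_diff x.1 x.2

theorem zero_mem_index : (0 : ℤ) ∈ C.index := ⟨by simp, by simp⟩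

/-- The basis element `b_0` at the base point, in degree `0` of `P(C)`. -/
def bBase : C.complex.X 0 := (⟨C.b 0, C.b_mem C.zero_mem_index C.mu_zero⟩ : C.piece 0)

end GWord

/-! ### The word `C(↙↘)` -/

open Classical in
/-- A letter `[γ⁻¹]`, with `γ` an arrow, such that `x [γ⁻¹]` may occur in a word, if there is one. -/
def nextInv (x : G.Letter) : Option G.Letter :=
  if h : ∃ y : G.Letter, y.IsInvArrow ∧ x.Adj y then some h.choose else none

open Classical in
/-- A letter `[α]`, with `α` an arrow, such that `[α] x` may occur in a word, if there is one. -/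
def prevDir (x : G.Letter) : Option G.Letter :=
  if h : ∃ y : G.Letter, y.IsDirArrow ∧ y.Adj x then some h.choose else none

/-- Iterate a partial function. -/
def iterOpt {α : Type*} (f : α → Option α) (s : Option α) : ℕ → Option α
  | 0 => s
  | n + 1 => (iterOpt f s n).bind f

namespace FinWord

variable {G} {v : V} {δ : ℤˣ} (C : G.FinWord v δ)

/-- The end vertex `h(C⁻¹)`. -/
def endVert : V := (C.letters.getLast?.map Letter.tl).getD v

/-- The sign `s(C⁻¹)` of the inverse word; `1_{v,δ}⁻¹ = 1_{v,-δ}`. -/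
def endSgn : ℤˣ := (C.letters.getLast?.map (fun x => x.flip.sgn)).getD (-δ)

open Classical in
/-- A letter `[γ⁻¹]`, with `γ` an arrow, such that `C [γ⁻¹]` is a word, if there is one. -/
def startRight : Option G.Letter :=
  if h : ∃ y : G.Letter, y.IsInvArrow ∧ C.endVert = y.hd ∧ C.endSgn = - y.sgn
  then some h.choose else none

variable (G v δ) in
open Classical in
/-- A letter `[α]`, with `α` an arrow, such that `[α] C` is a word for a (equivalently, every) word
`C` of head `v` and sign `δ`, if there is one. -/
def startLeft : Option G.Letter :=
  if h : ∃ y : G.Letter, y.IsDirArrow ∧ y.tl = v ∧ y.flip.sgn = - δ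
  then some h.choose else none

/-- The letters of `C(↙↘)` to the right of the base point: those of `C`, followed by letters
`[γ₁⁻¹] [γ₂⁻¹] ⋯`, with `γᵢ` arrows, as long as this gives a word. As `Λ` is gentle the next letter
is unique in each step, so that this is the longest possible sequence. -/
def right (n : ℕ) : Option G.Letter :=
  if n < C.letters.length then C.letters[n]?
  else iterOpt G.nextInv C.startRight (n - C.letters.length)

variable (G v δ) in
/-- The letters `⋯ [α₂] [α₁]` of `C(↙↘)` to the left of the base point (from right to left), with
`αᵢ` arrows, as long as this gives a word. Again the next letter is unique in each step. -/
def left (n : ℕ) : Option G.Letter := iterOpt G.prevDir (startLeft G v δ) n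

/-- The letters of `C(↙↘)`; those of `C` are at `1, …, t`. -/
def extLetter (i : ℤ) : Option G.Letter :=
  if i ≤ 0 then left G v δ (-i).toNat else C.right (i - 1).toNat

end FinWord

namespace Letter

variable {G}

theorem invArrow_unique {x y : G.Letter} (hx : x.IsInvArrow) (hy : y.IsInvArrow)
    (h : x.hd = y.hd) (hs : x.sgn = y.sgn) : x = y := by
  rcases x with γ | γ
  · exact hx.elim
  rcases y with μ | μ
  · exact hy.elim
  have h1 : γ.last = μ.last := sign_hd_eq (G := G) h (neg_inj.1 hs)
  rcases γ with ⟨p, hp, _, _⟩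
  rcases μ with ⟨q, hq, _, _⟩
  obtain ⟨a, rfl⟩ := List.length_eq_one_iff.1 hx
  obtain ⟨b, rfl⟩ := List.length_eq_one_iff.1 hy
  have h2 : a = b := h1
  subst h2
  rfl

theorem flip_hd (x : G.Letter) : x.flip.hd = x.tl := by cases x <;> rfl

theorem isInvArrow_flip (x : G.Letter) : x.flip.IsInvArrow ↔ x.IsDirArrow := by
  cases x <;> rfl

theorem dirArrow_unique {x y : G.Letter} (hx : x.IsDirArrow) (hy : y.IsDirArrow)
    (h : x.tl = y.tl) (hs : x.flip.sgn = y.flip.sgn) : x = y := by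
  have h1 : x.flip = y.flip := invArrow_unique ((isInvArrow_flip x).2 hx)
    ((isInvArrow_flip y).2 hy) (by rw [flip_hd, flip_hd, h]) hs
  rcases x with γ | γ
  · rcases y with μ | μ
    · cases h1; rfl
    · exact hy.elim
  · exact hx.elim

end Letter

theorem nextInv_eq_some {x y : G.Letter} :
    G.nextInv x = some y ↔ y.IsInvArrow ∧ x.Adj y := by
  unfold nextInv
  constructor
  · intro h
    split at h
    · rename_i hex
      cases h
      exact hex.choose_spec
    · cases h
  · intro h
    have hex : ∃ y : G.Letter, y.IsInvArrow ∧ x.Adj y := ⟨y, h⟩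
    rw [dif_pos hex]
    have h1 := hex.choose_spec
    have h2 := (Letter.adj_iff _ _).1 h1.2
    have h3 := (Letter.adj_iff _ _).1 h.2
    exact congrArg some (Letter.invArrow_unique h1.1 h.1 (h2.1.symm.trans h3.1)
      (h2.2.trans h3.2.symm))

theorem prevDir_eq_some {x y : G.Letter} :
    G.prevDir x = some y ↔ y.IsDirArrow ∧ y.Adj x := by
  unfold prevDir
  constructor
  · intro h
    split at h
    · rename_i hex
      cases h
      exact hex.choose_spec
    · cases h
  · intro h
    have hex : ∃ y : G.Letter, y.IsDirArrow ∧ y.Adj x := ⟨y, h⟩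
    rw [dif_pos hex]
    have h1 := hex.choose_spec
    have h2 := (Letter.adj_iff _ _).1 h1.2
    have h3 := (Letter.adj_iff _ _).1 h.2
    exact congrArg some (Letter.dirArrow_unique h1.1 h.1 (h2.1.trans h3.1.symm)
      (neg_inj.1 (h2.2.symm.trans h3.2)))

theorem iterOpt_succ_eq_some {α : Type*} {f : α → Option α} {s : Option α} {n : ℕ} {y : α} :
    iterOpt f s (n + 1) = some y ↔ ∃ x, iterOpt f s n = some x ∧ f x = some y := by
  simp [iterOpt, Option.bind_eq_some_iff]

theorem iterOpt_succ_none {α : Type*} {f : α → Option α} {s : Option α} {n : ℕ}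
    (h : iterOpt f s n = none) : iterOpt f s (n + 1) = none := by
  simp [iterOpt, h]

namespace FinWord

variable {G} {v : V} {δ : ℤˣ} (C : G.FinWord v δ)

theorem startRight_eq_some {y : G.Letter} : C.startRight = some y ↔
    y.IsInvArrow ∧ C.endVert = y.hd ∧ C.endSgn = - y.sgn := by
  unfold startRight
  constructor
  · intro h
    split at h
    · rename_i hex
      cases h
      exact hex.choose_spec
    · cases h
  · intro h
    have hex : ∃ y : G.Letter, y.IsInvArrow ∧ C.endVert = y.hd ∧ C.endSgn = - y.sgn := ⟨y, h⟩
    rw [dif_pos hex]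
    have h1 := hex.choose_spec
    exact congrArg some (Letter.invArrow_unique h1.1 h.1 (h1.2.1.symm.trans h.2.1)
      (neg_inj.1 (h1.2.2.symm.trans h.2.2)))

theorem startLeft_eq_some {y : G.Letter} : startLeft G v δ = some y ↔
    y.IsDirArrow ∧ y.tl = v ∧ y.flip.sgn = - δ := by
  unfold startLeft
  constructor
  · intro h
    split at h
    · rename_i hex
      cases h
      exact hex.choose_spec
    · cases h
  · intro h
    have hex : ∃ y : G.Letter, y.IsDirArrow ∧ y.tl = v ∧ y.flip.sgn = - δ := ⟨y, h⟩
    rw [dif_pos hex]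
    have h1 := hex.choose_spec
    exact congrArg some (Letter.dirArrow_unique h1.1 h.1 (h1.2.1.trans h.2.1.symm)
      (h1.2.2.trans h.2.2.symm))

theorem right_of_lt {n : ℕ} (h : n < C.letters.length) : C.right n = some C.letters[n] := by
  simp [right, h]

theorem right_of_ge {n : ℕ} (h : C.letters.length ≤ n) :
    C.right n = iterOpt G.nextInv C.startRight (n - C.letters.length) := by
  simp [right, h.not_gt]

theorem right_closed {n : ℕ} (h : C.right n = none) : C.right (n + 1) = none := by
  rcases lt_or_ge n C.letters.length with hn | hn
  · rw [C.right_of_lt hn] at h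
    cases h
  · rw [C.right_of_ge hn] at h
    rw [C.right_of_ge (by lia), Nat.sub_add_comm hn]
    exact iterOpt_succ_none h

theorem right_zero {y : G.Letter} (h : C.right 0 = some y) : y.hd = v ∧ y.sgn = δ := by
  rcases C with ⟨_ | ⟨x, L⟩, hc, hs⟩
  · rw [right_of_ge _ (by simp)] at h
    have h1 := (startRight_eq_some _).1 h
    refine ⟨?_, ?_⟩
    · simpa [endVert] using h1.2.1.symm
    · simpa [endSgn] using h1.2.2.symm
  · rw [right_of_lt _ (by simp)] at h
    cases h
    exact hs _ rfl

theorem right_adj {n : ℕ} {x y : G.Letter} (hx : C.right n = some x)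
    (hy : C.right (n + 1) = some y) : x.Adj y := by
  rcases lt_trichotomy (n + 1) C.letters.length with hn | hn | hn
  · rw [C.right_of_lt (by lia)] at hx
    rw [C.right_of_lt hn] at hy
    cases hx; cases hy
    exact List.isChain_iff_getElem.1 C.chain n hn
  · rw [C.right_of_lt (by lia)] at hx
    rw [C.right_of_ge hn.ge, hn, Nat.sub_self] at hy
    have h1 := C.startRight_eq_some.1 hy
    have h2 : C.letters.getLast? = some x := by
      rw [List.getLast?_eq_getElem?, ← hn, Nat.add_sub_cancel,
        List.getElem?_eq_getElem (by lia)]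
      exact hx
    simp only [endVert, endSgn, h2, Option.map_some, Option.getD_some] at h1
    rw [Letter.adj_iff]
    exact ⟨h1.2.1, by rw [h1.2.2, neg_neg]⟩
  · rw [C.right_of_ge (by lia)] at hx
    rw [C.right_of_ge hn.le, Nat.sub_add_comm (by lia)] at hy
    obtain ⟨z, hz, hzy⟩ := iterOpt_succ_eq_some.1 hy
    rw [hx] at hz
    cases hz
    exact (G.nextInv_eq_some.1 hzy).2

theorem extLetter_of_le {i : ℤ} (h : i ≤ 0) : C.extLetter i = left G v δ (-i).toNat := by
  simp [extLetter, h]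

theorem extLetter_of_pos {i : ℤ} (h : 0 < i) : C.extLetter i = C.right (i - 1).toNat := by
  simp [extLetter, h.not_ge]

/-- The word `C(↙↘)`, with base point at the place where `C` begins. -/
def ext : G.GWord where
  base := v
  letter := C.extLetter
  adj i x y hx hy := by
    rcases lt_trichotomy i 0 with h | h | h
    · rw [C.extLetter_of_le h.le, show (-i).toNat = (-(i + 1)).toNat + 1 by lia] at hx
      rw [C.extLetter_of_le (by lia)] at hy
      obtain ⟨z, hz, hzx⟩ := iterOpt_succ_eq_some.1 hx
      have h1 : some y = some z := hy.symm.trans hz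
      cases h1
      exact (G.prevDir_eq_some.1 hzx).2
    · subst h
      rw [C.extLetter_of_le le_rfl] at hx
      rw [C.extLetter_of_pos (by lia)] at hy
      have h1 := C.right_zero hy
      have h2 := startLeft_eq_some.1 hx
      rw [Letter.adj_iff, h1.1, h1.2, h2.2.1, h2.2.2, neg_neg]
      exact ⟨rfl, rfl⟩
    · rw [C.extLetter_of_pos h] at hx
      rw [C.extLetter_of_pos (by lia), show (i + 1 - 1).toNat = (i - 1).toNat + 1 by lia] at hy
      exact C.right_adj hx hy
  right_closed i hi h := by
    rw [C.extLetter_of_pos hi] at h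
    rw [C.extLetter_of_pos (by lia), show (i + 1 - 1).toNat = (i - 1).toNat + 1 by lia]
    exact C.right_closed h
  left_closed i hi h := by
    rw [C.extLetter_of_le hi] at h
    rw [C.extLetter_of_le (by lia), show (-(i - 1)).toNat = (-i).toNat + 1 by lia]
    exact iterOpt_succ_none h
  base_hd x hx := by
    rw [C.extLetter_of_pos (by lia)] at hx
    exact (C.right_zero hx).1
  base_tl x hx := by
    rw [C.extLetter_of_le le_rfl] at hx
    exact (startLeft_eq_some.1 hx).2.1

end FinWord

/-! ### The morphism `a⟨C⟩` -/

theorem NzPath.ext_arrows {γ μ : G.NzPath} (h : γ.arrows = μ.arrows) : γ = μ := by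
  cases γ; cases μ; cases h; rfl

/-- The arrow `l(γ)` again lies in `𝐏`. -/
theorem NzPath.exists_last (γ : G.NzPath) : ∃ μ : G.NzPath, μ.arrows = [γ.last] := by
  refine ⟨⟨[γ.last], by simp, List.isChain_singleton _, ?_⟩, rfl⟩
  intro hm
  apply γ.not_mem
  have h1 : γ.arrows = [γ.last] ++ γ.arrows.tail := (List.cons_head_tail γ.ne_nil).symm
  have h2 : G.Q.pathProd k γ.arrows =
      G.Q.pathProd k [γ.last] * G.Q.pathProd k γ.arrows.tail := by
    conv_lhs => rw [h1]
    simp [QuiverRel.pathProd]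
  rw [h2]
  exact TwoSidedIdeal.mul_mem_right _ _ _ hm

theorem e_mul_word {p : List A} (hp : p ≠ []) :
    G.e (G.Q.hd (p.head hp)) * G.word p = G.word p := by
  rcases p with _ | ⟨a, p⟩
  · exact absurd rfl hp
  · rw [word_cons, ← mul_assoc]
    exact congrArg (· * G.word p) (G.e_mul_ar a)

theorem NzPath.e_mul_rest (γ : G.NzPath) (h : ¬ γ.IsArrow) :
    G.e (G.Q.tl γ.last) * γ.rest = γ.rest := by
  rcases γ with ⟨_ | ⟨a, _ | ⟨c, p⟩⟩, hne, hp, hn⟩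
  · exact absurd rfl hne
  · exact absurd rfl h
  · have h1 : G.Q.tl a = G.Q.hd c := (List.isChain_cons_cons.1 hp).1
    have h2 : G.e (G.Q.hd c) * G.word (c :: p) = G.word (c :: p) :=
      G.e_mul_word (p := c :: p) (by simp)
    change G.e (G.Q.tl a) * G.word (c :: p) = G.word (c :: p)
    rw [h1, h2]

theorem NzPath.rest_mul (γ μ : G.NzPath) (h : ¬ γ.IsArrow)
    (hm : G.Q.arrow k γ.first * G.Q.arrow k μ.last ∈ G.Q.ideal k) : γ.rest * μ.val = 0 := by
  rcases γ with ⟨_ | ⟨a, _ | ⟨c, p⟩⟩, hne, hp, hn⟩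
  · exact absurd rfl hne
  · exact absurd rfl h
  · exact G.word_mul_eq_zero (p := c :: p) (by simp) hm

namespace FinWord

variable {G} {v : V} {δ : ℤˣ} (C : G.FinWord v δ)

/-- All letters `[C_1], …, [C_i]` of `C(↙↘)` are inverses of arrows (and `i ∈ I`). In the notation
where `C(↘) = B l⁻¹ r D`, with `B` the longest initial part consisting of `q` pairs of the form
`d_α⁻¹ α`, this says that `i ≤ q`. -/
def Flat (i : ℤ) : Prop :=
  i ∈ C.ext.index ∧ ∀ j, 0 < j → j ≤ i → ∃ x, C.ext.letter j = some x ∧ x.IsInvArrow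

open Classical in
/-- The image of `b_i` under `a⟨C⟩ : P(1_{v,δ}(↙↘)) → P(C(↙↘))`: it is `b_i` for `i ≤ q`, it is
`λ b_{q+1}` if `i = q + 1` and `l⁻¹ r = d_{l(γ)}⁻¹ γ` with `γ = l(γ) λ`, and it is `0` otherwise.
If `C(↙↘) = 1_{v,δ}(↙↘)` then every `b_i` is mapped to `b_i`. -/
def aVal (i : ℤ) : ℤ →₀ G.Alg :=
  if C.Flat i then C.ext.b i
  else if 0 < i ∧ C.Flat (i - 1) then
    match C.ext.letter i with
    | some (Letter.inv γ) => γ.rest • C.ext.b i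
    | _ => 0
  else 0

/-- The `Λ`-linear map underlying `a⟨C⟩`. -/
def aLin : (ℤ →₀ G.Alg) →ₗ[G.Alg] (ℤ →₀ G.Alg) := Finsupp.linearCombination G.Alg C.aVal

/-- The word `1_{v,δ}(↙↘)`. -/
abbrev triv (G : GentleData k V A) (v : V) (δ : ℤˣ) : G.GWord := (G.trivWord v δ).ext

theorem triv_right (n : ℕ) : (G.trivWord v δ).right n =
    iterOpt G.nextInv (G.trivWord v δ).startRight n := by
  rw [right_of_ge _ (Nat.zero_le _)]
  rfl

theorem triv_start {y : G.Letter} :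
    (G.trivWord v δ).startRight = some y ↔ y.IsInvArrow ∧ y.hd = v ∧ y.sgn = δ := by
  rw [startRight_eq_some]
  simp only [endVert, endSgn, trivWord, List.getLast?_nil, Option.map_none, Option.getD_none,
    neg_inj]
  exact and_congr_right fun _ => ⟨fun h => ⟨h.1.symm, h.2.symm⟩, fun h => ⟨h.1.symm, h.2.symm⟩⟩

theorem triv_letter_pos {i : ℤ} (hi : 0 < i) {x : G.Letter}
    (hx : (triv G v δ).letter i = some x) : x.IsInvArrow := by
  change (G.trivWord v δ).extLetter i = some x at hx
  rw [extLetter_of_pos _ hi, triv_right] at hx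
  rcases hn : (i - 1).toNat with _ | n
  · rw [hn] at hx
    exact (triv_start.1 hx).1
  · rw [hn] at hx
    obtain ⟨z, -, hz⟩ := iterOpt_succ_eq_some.1 hx
    exact (G.nextInv_eq_some.1 hz).1

theorem triv_letter_le {i : ℤ} (hi : i ≤ 0) {x : G.Letter}
    (hx : (triv G v δ).letter i = some x) : x.IsDirArrow := by
  change (G.trivWord v δ).extLetter i = some x at hx
  rw [extLetter_of_le _ hi, left] at hx
  rcases hn : (-i).toNat with _ | n
  · rw [hn] at hx
    exact (startLeft_eq_some.1 hx).1
  · rw [hn] at hx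
    obtain ⟨z, -, hz⟩ := iterOpt_succ_eq_some.1 hx
    exact (G.prevDir_eq_some.1 hz).1

theorem letter_le {i : ℤ} (hi : i ≤ 0) : (triv G v δ).letter i = C.ext.letter i := by
  change (G.trivWord v δ).extLetter i = C.extLetter i
  rw [extLetter_of_le _ hi, extLetter_of_le _ hi]

theorem triv_letter_next {i : ℤ} (hi : 0 < i)
    (hprev : (triv G v δ).letter (i - 1) = C.ext.letter (i - 1)) {γ : G.NzPath}
    (hγ : C.ext.letter i = some (Letter.inv γ)) :
    ∃ μ : G.NzPath, μ.arrows = [γ.last] ∧ (triv G v δ).letter i = some (Letter.inv μ) := by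
  obtain ⟨μ, hμ⟩ := γ.exists_last
  refine ⟨μ, hμ, ?_⟩
  have hlast : μ.last = γ.last := by simp [NzPath.last, hμ]
  have harr : (Letter.inv μ).IsInvArrow := by simp [Letter.IsInvArrow, NzPath.IsArrow, hμ]
  have hhd : (Letter.inv μ).hd = (Letter.inv γ).hd := by simp [Letter.hd, NzPath.hd, hlast]
  have hsg : (Letter.inv μ).sgn = (Letter.inv γ).sgn := by simp [Letter.sgn, hlast]
  change (G.trivWord v δ).extLetter i = _
  change (G.trivWord v δ).extLetter (i - 1) = C.extLetter (i - 1) at hprev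
  change C.extLetter i = _ at hγ
  rw [extLetter_of_pos _ hi] at hγ ⊢
  rw [triv_right]
  rcases hn : (i - 1).toNat with _ | n
  · rw [hn] at hγ
    have h1 := C.right_zero hγ
    exact triv_start.2 ⟨harr, hhd.trans h1.1, hsg.trans h1.2⟩
  · rw [hn] at hγ
    rw [extLetter_of_pos _ (by lia), extLetter_of_pos _ (by lia), triv_right,
      show (i - 1 - 1).toNat = n by lia] at hprev
    rcases hx : C.right n with _ | x
    · rw [C.right_closed hx] at hγ
      cases hγ
    · rw [hx] at hprev
      refine iterOpt_succ_eq_some.2 ⟨x, hprev, G.nextInv_eq_some.2 ⟨harr, ?_⟩⟩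
      have h1 := (Letter.adj_iff _ _).1 (C.right_adj hx hγ)
      exact (Letter.adj_iff _ _).2 ⟨h1.1.trans hhd.symm, hsg.trans h1.2⟩

theorem letter_eq_of_flat {i : ℤ} (hi : C.Flat i) :
    ∀ j, j ≤ max i 0 → (triv G v δ).letter j = C.ext.letter j := by
  intro j hj
  rcases le_or_gt j 0 with h0 | h0
  · exact C.letter_le h0
  · have h1 : 0 ≤ j := h0.le
    clear h0
    induction j, h1 using Int.leInduction with
    | base => exact C.letter_le le_rfl
    | succ n hn ih =>
      have ih' := ih (by lia)
      obtain ⟨x, hx, hxa⟩ := hi.2 (n + 1) (by lia) (by lia)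
      rcases x with γ | γ
      · exact hxa.elim
      · obtain ⟨μ, hμ, hl⟩ := C.triv_letter_next (i := n + 1) (by lia)
          (by rw [add_sub_cancel_right]; exact ih') hx
        rw [hl, hx]
        have : μ = γ := NzPath.ext_arrows (G := G) <| by
          obtain ⟨a, ha⟩ := List.length_eq_one_iff.1 hxa
          rw [hμ, ha]
          simp [NzPath.last, ha]
        rw [this]

theorem mu_eq_of_flat {i : ℤ} (hi : C.Flat i) : (triv G v δ).mu i = C.ext.mu i := by
  unfold GWord.mu
  congr 1
  · refine Finset.sum_congr rfl fun j hj => ?_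
    rw [Finset.mem_Ioc] at hj
    rw [GWord.letterDeg, GWord.letterDeg, C.letter_eq_of_flat hi j (by lia)]
  · refine Finset.sum_congr rfl fun j hj => ?_
    rw [Finset.mem_Ioc] at hj
    rw [GWord.letterDeg, GWord.letterDeg, C.letter_eq_of_flat hi j (by lia)]

theorem vert_eq_of_flat {i : ℤ} (hi : C.Flat i) : (triv G v δ).vert i = C.ext.vert i := by
  unfold GWord.vert
  rw [C.letter_eq_of_flat hi i (by lia)]
  rcases lt_or_ge i 0 with h | h
  · rw [C.letter_eq_of_flat hi (i + 1) (by lia)]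
    rfl
  · simp only [h.not_gt, if_false]
    rfl

theorem flat_of_le {i : ℤ} (hi : i ≤ 0) (hmem : i ∈ (triv G v δ).index) : C.Flat i := by
  refine ⟨⟨fun h => absurd h hi.not_gt, fun h => ?_⟩, fun j h1 h2 => by lia⟩
  have := hmem.2 h
  rwa [C.letter_le (by lia)] at this

theorem aVal_flat {i : ℤ} (h : C.Flat i) : C.aVal i = C.ext.b i := by simp [aVal, h]

theorem aVal_next {i : ℤ} (h : ¬ C.Flat i) (h0 : 0 < i) (h1 : C.Flat (i - 1)) {γ : G.NzPath}
    (hγ : C.ext.letter i = some (Letter.inv γ)) : C.aVal i = γ.rest • C.ext.b i := by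
  simp [aVal, h, h0, h1, hγ]

theorem aVal_zero {i : ℤ} (h : ¬ C.Flat i)
    (h1 : 0 < i → C.Flat (i - 1) → ∀ γ, C.ext.letter i ≠ some (Letter.inv γ)) :
    C.aVal i = 0 := by
  unfold aVal
  rw [if_neg h]
  split
  · rename_i h2
    split
    · exact absurd ‹_› (h1 h2.1 h2.2 _)
    · rfl
  · rfl

theorem not_arrow_of_not_flat {i : ℤ} (h : ¬ C.Flat i) (h1 : C.Flat (i - 1)) {γ : G.NzPath}
    (hγ : C.ext.letter i = some (Letter.inv γ)) : ¬ γ.IsArrow := by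
  intro ha
  refine h ⟨(C.ext.vert_of_letter hγ).2.2.1, fun j h2 h3 => ?_⟩
  rcases h3.lt_or_eq with h4 | rfl
  · exact h1.2 j h2 (by lia)
  · exact ⟨_, hγ, ha⟩

theorem e_smul_aVal (i : ℤ) : G.e ((triv G v δ).vert i) • C.aVal i = C.aVal i := by
  by_cases h : C.Flat i
  · rw [C.aVal_flat h, C.vert_eq_of_flat h, GWord.b, Finsupp.smul_single, smul_eq_mul, triv_idem]
  · by_cases h1 : 0 < i ∧ C.Flat (i - 1) ∧ ∃ γ, C.ext.letter i = some (Letter.inv γ)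
    · obtain ⟨h0, h1, γ, hγ⟩ := h1
      obtain ⟨μ, hμ, hl⟩ := C.triv_letter_next h0
        (C.letter_eq_of_flat h1 (i - 1) (by lia)) hγ
      have hv := ((triv G v δ).vert_of_letter hl).1
      have hv' : (Letter.inv μ : G.Letter).tl = G.Q.tl γ.last := by
        simp [Letter.tl, NzPath.tl, NzPath.first, hμ]
      rw [C.aVal_next h h0 h1 hγ, hv, hv', smul_smul,
        NzPath.e_mul_rest G γ (C.not_arrow_of_not_flat h h1 hγ)]
    · rw [C.aVal_zero h fun h2 h3 γ hγ => h1 ⟨h2, h3, γ, hγ⟩, smul_zero]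

theorem aLin_b (i : ℤ) : C.aLin ((triv G v δ).b i) = C.aVal i := by
  rw [aLin, GWord.b, Finsupp.linearCombination_single, e_smul_aVal]

theorem aVal_mem {i n : ℤ} (hn : (triv G v δ).mu i = n) : C.aVal i ∈ C.ext.piece n := by
  by_cases h : C.Flat i
  · rw [C.aVal_flat h]
    exact C.ext.b_mem h.1 (by rw [← C.mu_eq_of_flat h, hn])
  · by_cases h1 : 0 < i ∧ C.Flat (i - 1) ∧ ∃ γ, C.ext.letter i = some (Letter.inv γ)
    · obtain ⟨h0, h1, γ, hγ⟩ := h1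
      obtain ⟨μ, hμ, hl⟩ := C.triv_letter_next h0
        (C.letter_eq_of_flat h1 (i - 1) (by lia)) hγ
      rw [C.aVal_next h h0 h1 hγ]
      refine Submodule.smul_mem _ _ (C.ext.b_mem (C.ext.vert_of_letter hγ).2.2.1 ?_)
      have h3 := C.ext.mu_add_one (i - 1)
      have h4 := (triv G v δ).mu_add_one (i - 1)
      rw [sub_add_cancel] at h3 h4
      rw [← hn, h3, h4, C.mu_eq_of_flat h1]
      simp [GWord.letterDeg, hγ, hl, Letter.deg]
    · rw [C.aVal_zero h fun h2 h3 γ hγ => h1 ⟨h2, h3, γ, hγ⟩]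
      exact Submodule.zero_mem _

theorem aLin_mem {n : ℤ} : ∀ x ∈ (triv G v δ).piece n, C.aLin x ∈ C.ext.piece n := by
  intro x hx
  have : (triv G v δ).piece n ≤ (C.ext.piece n).comap C.aLin := by
    refine Submodule.span_le.2 ?_
    rintro _ ⟨i, -, hn, rfl⟩
    change C.aLin _ ∈ C.ext.piece n
    rw [aLin_b]
    exact C.aVal_mem hn
  exact this hx

theorem flat_pred {i : ℤ} (h0 : 0 < i) (h : C.Flat i) : C.Flat (i - 1) := by
  obtain ⟨x, hx, -⟩ := h.2 i h0 le_rfl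
  exact ⟨(C.ext.vert_of_letter hx).2.2.2, fun j h1 h2 => h.2 j h1 (by lia)⟩

theorem aLin_bMinus {i : ℤ} (h : C.Flat i) :
    C.aLin ((triv G v δ).bMinus i) = C.ext.bMinus i := by
  have hl := C.letter_eq_of_flat h i (by lia)
  by_cases hd : ∃ β, C.ext.letter i = some (Letter.dir β)
  · obtain ⟨β, hβ⟩ := hd
    have hβ' := hl.trans hβ
    have h0 : i ≤ 0 := by
      by_contra h0
      exact triv_letter_pos (by lia) hβ'
    rw [C.ext.bMinus_of hβ, (triv G v δ).bMinus_of hβ', map_smul, aLin_b, C.aVal_flat]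
    exact C.flat_of_le (by lia) ((triv G v δ).vert_of_letter hβ').2.2.2
  · have hd' : ∀ β, C.ext.letter i ≠ some (Letter.dir β) := by simpa using hd
    rw [C.ext.bMinus_of_not hd', (triv G v δ).bMinus_of_not (by rw [hl]; exact hd'), map_zero]

theorem aLin_bPlus {i : ℤ} (h : C.Flat i) :
    C.aLin ((triv G v δ).bPlus i) = C.ext.bPlus i := by
  rcases lt_or_ge i 0 with hi | hi
  · have hl := C.letter_eq_of_flat h (i + 1) (by lia)
    have hd : ∀ β, (triv G v δ).letter (i + 1) ≠ some (Letter.inv β) := fun β hβ =>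
      triv_letter_le (by lia) hβ
    rw [C.ext.bPlus_of_not (by rw [← hl]; exact hd), (triv G v δ).bPlus_of_not hd, map_zero]
  · have hpred : (triv G v δ).letter (i + 1 - 1) = C.ext.letter (i + 1 - 1) :=
      C.letter_eq_of_flat h _ (by lia)
    by_cases hd : ∃ γ, C.ext.letter (i + 1) = some (Letter.inv γ)
    · obtain ⟨γ, hγ⟩ := hd
      obtain ⟨μ, hμ, hl⟩ := C.triv_letter_next (by lia) hpred hγ
      rw [C.ext.bPlus_of hγ, (triv G v δ).bPlus_of hl, map_smul, aLin_b]
      have hval : μ.val = G.ar γ.last := by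
        simp [NzPath.val, hμ, word, QuiverRel.pathProd, ar]
      by_cases hf : C.Flat (i + 1)
      · have h2 := C.letter_eq_of_flat hf (i + 1) (by lia)
        rw [hl, hγ] at h2
        cases h2
        rw [C.aVal_flat hf]
      · rw [C.aVal_next hf (by lia) (by rwa [add_sub_cancel_right]) hγ, smul_smul, hval,
          ← NzPath.val_eq]
    · have hd' : ∀ γ, C.ext.letter (i + 1) ≠ some (Letter.inv γ) := by simpa using hd
      rw [C.ext.bPlus_of_not hd']
      have hf : ¬ C.Flat (i + 1) := by
        intro hf
        obtain ⟨x, hx, hxa⟩ := hf.2 (i + 1) (by lia) le_rfl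
        rcases x with γ | γ
        · exact hxa
        · exact hd' γ hx
      by_cases ht : ∃ γ, (triv G v δ).letter (i + 1) = some (Letter.inv γ)
      · obtain ⟨γ, hγ⟩ := ht
        rw [(triv G v δ).bPlus_of hγ, map_smul, aLin_b, C.aVal_zero hf fun _ _ => hd', smul_zero]
      · rw [(triv G v δ).bPlus_of_not (by simpa using ht), map_zero]

theorem aLin_diff_b {i : ℤ} (hi : i ∈ (triv G v δ).index) :
    C.aLin ((triv G v δ).diff ((triv G v δ).b i)) = C.ext.diff (C.aLin ((triv G v δ).b i)) := by
  rw [GWord.diff_b, map_add, aLin_b]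
  by_cases h : C.Flat i
  · rw [C.aVal_flat h, GWord.diff_b, C.aLin_bMinus h, C.aLin_bPlus h]
  · have h0 : 0 < i := by
      by_contra h0
      exact h (C.flat_of_le (by lia) hi)
    have hm : (triv G v δ).bMinus i = 0 := (triv G v δ).bMinus_of_not fun β hβ =>
      triv_letter_pos h0 hβ
    have hp : C.aLin ((triv G v δ).bPlus i) = 0 := by
      by_cases ht : ∃ γ, (triv G v δ).letter (i + 1) = some (Letter.inv γ)
      · obtain ⟨γ, hγ⟩ := ht
        have hf : ¬ C.Flat (i + 1) := fun hf => h (by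
          have := C.flat_pred (by lia) hf
          rwa [add_sub_cancel_right] at this)
        rw [(triv G v δ).bPlus_of hγ, map_smul, aLin_b, C.aVal_zero hf, smul_zero]
        intro _ h2
        rw [add_sub_cancel_right] at h2
        exact absurd h2 h
      · rw [(triv G v δ).bPlus_of_not (by simpa using ht), map_zero]
    rw [hm, hp, map_zero, zero_add]
    by_cases h1 : C.Flat (i - 1) ∧ ∃ γ, C.ext.letter i = some (Letter.inv γ)
    · obtain ⟨h1, γ, hγ⟩ := h1
      rw [C.aVal_next h h0 h1 hγ, map_smul, GWord.diff_b,
        C.ext.bMinus_of_not (by simp [hγ]), zero_add]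
      by_cases h2 : ∃ μ, C.ext.letter (i + 1) = some (Letter.inv μ)
      · obtain ⟨μ, hμ⟩ := h2
        have hadj := C.ext.adj i _ _ hγ hμ
        rw [C.ext.bPlus_of hμ, smul_smul,
          NzPath.rest_mul G γ μ (C.not_arrow_of_not_flat h h1 hγ) hadj.2, zero_smul]
      · rw [C.ext.bPlus_of_not (by simpa using h2), smul_zero]
    · rw [C.aVal_zero h fun _ h3 γ hγ => h1 ⟨h3, γ, hγ⟩, map_zero]

theorem aLin_diff {n : ℤ} : ∀ x ∈ (triv G v δ).piece n,
    C.aLin ((triv G v δ).diff x) = C.ext.diff (C.aLin x) := by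
  intro x hx
  have : (triv G v δ).piece n ≤
      LinearMap.eqLocus (C.aLin ∘ₗ (triv G v δ).diff) (C.ext.diff ∘ₗ C.aLin) := by
    refine Submodule.span_le.2 ?_
    rintro _ ⟨i, hi, -, rfl⟩
    exact C.aLin_diff_b hi
  exact this hx

/-- The morphism of complexes `a⟨C⟩ : P(1_{v,δ}(↙↘)) ⟶ P(C(↙↘))`. -/
def compactMap : (triv G v δ).complex ⟶ C.ext.complex where
  f n := ModuleCat.ofHom (C.aLin.restrict C.aLin_mem)
  comm' n m h := by
    have h1 : n + 1 = m := h
    simp only [GWord.complex, dif_pos h1]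
    refine ModuleCat.hom_ext (LinearMap.ext fun x => Subtype.ext ?_)
    exact (C.aLin_diff x.1 x.2).symm

end FinWord

/-! ### The subspaces `C M` of a complex `M` -/

variable {G}

section Subspaces

variable (M : CochainComplex (ModuleCat.{u} G.Alg) ℤ)

/-- The `Λ`-module `⊕ M^i`. -/
abbrev Total : Type u := ⨁ i : ℤ, M.X i

/-- The endomorphism `d_M` of `⊕ M^i`. -/
def totalD : Total M →ₗ[G.Alg] Total M :=
  DirectSum.toModule G.Alg ℤ (Total M) fun i =>
    (DirectSum.lof G.Alg ℤ (fun i => M.X i) (i + 1)).comp (M.d i (i + 1)).hom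

/-- `e_v M`. -/
def vertexPart (v : V) : Set (Total M) := {m | G.e v • m = m}

open Classical in
/-- `d_{α,M}(m) = y`, for `m ∈ e_{h(α)} M`: there is an expression `d_M(m) = ∑ β m_β`, over the
arrows `β` with head `h(α)`, with `y = α m_α`. (For `M` homotopically minimal with projective terms
there is exactly one such `y`, as `e_v rad(M)` is the direct sum of the subspaces `β M`.) -/
def IsArrowD (α : A) (m y : Total M) : Prop :=
  m ∈ vertexPart M (G.Q.hd α) ∧ ∃ c : A → Total M,
    totalD M m = ∑ β ∈ Finset.univ.filter (fun β => G.Q.hd β = G.Q.hd α), G.ar β • c β ∧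
    y = G.ar α • c α

/-- `γ U`. -/
def pathImage (γ : G.NzPath) (U : Set (Total M)) : Set (Total M) := {x | ∃ m ∈ U, x = γ.val • m}

/-- `γ⁻¹ U`. -/
def pathPreimage (γ : G.NzPath) (U : Set (Total M)) : Set (Total M) :=
  {m | m ∈ vertexPart M γ.tl ∧ γ.val • m ∈ U}

/-- `d_α U`. -/
def dImage (α : A) (U : Set (Total M)) : Set (Total M) := {y | ∃ m ∈ U, IsArrowD M α m y}

/-- `d_α⁻¹ U`. -/
def dPreimage (α : A) (U : Set (Total M)) : Set (Total M) :=
  {m | m ∈ vertexPart M (G.Q.hd α) ∧ ∃ y ∈ U, IsArrowD M α m y}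

/-- `l⁻¹ r U` for a pair `l⁻¹ r` of homotopy letters. -/
def Letter.act : G.Letter → Set (Total M) → Set (Total M)
  | .dir γ, U => pathPreimage M γ (dImage M γ.last U)
  | .inv γ, U => dPreimage M γ.last (pathImage M γ U)

/-- `C M = l₁⁻¹ r₁ ⋯ l_t⁻¹ r_t e_u M`, where `u` is the end vertex of `C`. -/
def FinWord.act {v : V} {δ : ℤˣ} (C : G.FinWord v δ) : Set (Total M) :=
  C.letters.foldr (fun x U => x.act M U) (vertexPart M C.endVert)

/-- `M` is a homotopically minimal complex of projective `Λ`-modules. -/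
structure IsMinimalProj : Prop where
  projective : ∀ n, Module.Projective G.Alg (M.X n)
  minimal : ∀ n, LinearMap.range (M.d n (n + 1)).hom ≤ Module.jacobson G.Alg (M.X (n + 1))

end Subspaces

/-- The subgroup `M a = {f a ∣ f : Y ⟶ M}` of `X ⟶ M`, for a morphism `a : X ⟶ Y`. -/
def ppSubgroup {T : Type*} [Category T] [Preadditive T] {X Y : T} (a : X ⟶ Y) (M : T) :
    AddSubgroup (X ⟶ M) :=
  (Preadditive.leftComp M a).range

/-- The shift by `r` which moves degree `0` to degree `r`. -/
abbrev degShift (r : ℤ) : CochainComplex (ModuleCat.{u} G.Alg) ℤ ⥤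
    CochainComplex (ModuleCat.{u} G.Alg) ℤ := shiftFunctor _ (-r)

/-- The base point element `b_0` of `P(C)`, as an element of degree `r` of the shifted complex. -/
def GWord.bShift (C : G.GWord) (r : ℤ) : ((degShift (G := G) r).obj C.complex).X r :=
  (CochainComplex.shiftFunctorObjXIso C.complex (-r) r 0 (by lia)).inv C.bBase

/-- The quotient functor from complexes to the homotopy category. -/
abbrev toK : CochainComplex (ModuleCat.{u} G.Alg) ℤ ⥤
    HomotopyCategory (ModuleCat.{u} G.Alg) (ComplexShape.up ℤ) :=
  HomotopyCategory.quotient _ _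

end GentleData

end

/-!
In the representation of `Λ` on the paths outside `𝓙`, an arrow sends distinct paths to distinct
paths or to zero, and different arrows produce paths with different last arrows. This passes to
torsionless modules: `∑ β x_β = 0` forces every `β x_β` to vanish, and `γ β x = 0` forces `β x = 0`
if `γ β` is not in `𝓙`.

Split `d m = ∑ β m_β`, for `m` at a place of `C(↙↘)`, according to the sign of `β`. By gentleness
there is at most one term of each sign, and the relation between `m` and the element at the
neighbouring place says that the term of the corresponding sign is the one by which `b_i⁺` or `b_i⁻`
prescribes the differential; for a direct letter this uses `d² = 0` and cancellation. So `m ∈ C M`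
means that `m` starts a sequence along `C` which can be continued along the added arrows, where
`d_{α,M}` itself provides the next element, and such a sequence is the image of the basis `b_i`
under a map commuting with the differentials. Signs turn it into a morphism `P(C(↙↘))[r] ⟶ M`.
Since `a⟨C⟩` maps `b₀` to `b₀`, this describes `C M`; the last assertion holds because every
morphism in the homotopy category comes from a morphism of complexes.
-/

noncomputable section

/-! ### Torsionless modules -/

/-- The module `T` is torsionless: its elements are separated by the linear forms `T → R`.
Projective modules are torsionless, and over `Λ` this is what makes the maps `d_{α,M}` well
defined. -/
def IsTorsionless (R T : Type*) [Ring R] [AddCommGroup T] [Module R T] : Prop :=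
  ∀ x : T, (∀ φ : T →ₗ[R] R, φ x = 0) → x = 0

theorem isTorsionless_of_projective (R T : Type*) [Ring R] [AddCommGroup T] [Module R T]
    [h : Module.Projective R T] : IsTorsionless R T := by
  obtain ⟨f, hf⟩ := Module.projective_def'.1 h
  intro x hx
  have hfx : f x = 0 := Finsupp.ext fun t => hx (Finsupp.lapply t ∘ₗ f)
  rw [← LinearMap.id_apply (R := R) x, ← hf, LinearMap.comp_apply, hfx, map_zero]

theorem IsTorsionless.directSum {ι R : Type*} [Ring R] {T : ι → Type*}
    [∀ i, AddCommGroup (T i)] [∀ i, Module R (T i)] (hT : ∀ i, IsTorsionless R (T i)) :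
    IsTorsionless R (⨁ i, T i) := fun _ hx =>
  DFinsupp.ext fun i => hT i _ fun φ => hx (φ ∘ₗ DirectSum.component R ι T i)

theorem isSemisimpleModule_span_singleton {k R T : Type*} [Field k] [Ring R] [Algebra k R]
    [AddCommGroup T] [Module R T] {y : T} (hy : ∀ x : R, ∃ c : k, x • y = algebraMap k R c • y) :
    IsSemisimpleModule R (Submodule.span R {y}) := by
  rcases eq_or_ne y 0 with rfl | hne
  · have : Subsingleton (Submodule.span R {(0 : T)}) :=
      (Submodule.subsingleton_iff_eq_bot).2 (Submodule.span_zero_singleton R)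
    exact { exists_isCompl := fun p => ⟨⊤, Subsingleton.elim ⊥ p ▸ isCompl_bot_top⟩ }
  have : IsSimpleModule R (Submodule.span R {y}) := by
    rw [isSimpleModule_iff_toSpanSingleton_surjective]
    refine ⟨Submodule.nontrivial_span_singleton hne, ?_⟩
    rintro ⟨z, hz⟩ hz0 ⟨w, hw⟩
    obtain ⟨x, rfl⟩ := Submodule.mem_span_singleton.1 hz
    obtain ⟨x', rfl⟩ := Submodule.mem_span_singleton.1 hw
    obtain ⟨c, hc⟩ := hy x
    have hc0 : c ≠ 0 := by
      rintro rfl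
      exact hz0 (Subtype.ext (by simpa using hc))
    refine ⟨x' * algebraMap k R c⁻¹, Subtype.ext ?_⟩
    change (x' * algebraMap k R c⁻¹) • x • y = x' • y
    rw [hc, smul_smul, mul_assoc, ← map_mul, inv_mul_cancel₀ hc0, map_one, mul_one]
  infer_instance

theorem exists_seq_of_forall_exists {α : Type*} {U : ℕ → Set α} {R : ℕ → α → α → Prop}
    (h : ∀ n, ∀ x ∈ U n, ∃ y ∈ U (n + 1), R n x y) {x : α} (hx : x ∈ U 0) :
    ∃ s : ℕ → α, s 0 = x ∧ ∀ n, R n (s n) (s (n + 1)) := by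
  choose f hf hR using h
  let s : ∀ n, U n := fun n => Nat.rec ⟨x, hx⟩ (fun n y => ⟨f n y y.2, hf n y y.2⟩) n
  exact ⟨fun n => (s n).1, rfl, fun n => hR n (s n).1 (s n).2⟩

namespace GentleData

/-! ### Generators of `Λ` -/

section Generators

variable {k V A : Type u} [Field k] [Fintype V] [Fintype A] (G : GentleData k V A)

@[elab_as_elim]
theorem alg_induction {P : G.Alg → Prop} (algebraMap : ∀ c : k, P (algebraMap k G.Alg c))
    (e : ∀ v, P (G.e v)) (ar : ∀ a, P (G.ar a)) (add : ∀ x y, P x → P y → P (x + y))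
    (mul : ∀ x y, P x → P y → P (x * y)) (x : G.Alg) : P x := by
  obtain ⟨y, rfl⟩ := RingCon.mk'_surjective (G.Q.ideal k).ringCon x
  obtain ⟨z, rfl⟩ := RingQuot.mkAlgHom_surjective k _ y
  change P (G.proj _)
  induction z using FreeAlgebra.induction with
  | grade0 c => rw [AlgHom.commutes]; exact algebraMap c
  | grade1 s => exact s.rec e ar
  | mul x y hx hy => rw [map_mul, map_mul]; exact mul _ _ hx hy
  | add x y hx hy => rw [map_add, map_add]; exact add _ _ hx hy

theorem sum_e : ∑ v, G.e v = 1 := by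
  have h := RingQuot.mkAlgHom_rel k (QuiverRel.PathRel.unit (Q := G.Q) (k := k))
  simpa only [map_sum, map_one, e, QuiverRel.triv] using congrArg G.proj h

theorem e_mul_e_of_ne {v w : V} (h : v ≠ w) : G.e v * G.e w = 0 := by
  have h' := RingQuot.mkAlgHom_rel k (QuiverRel.PathRel.orth (Q := G.Q) (k := k) v w h)
  simpa only [map_mul, map_zero, e, QuiverRel.triv] using congrArg G.proj h'

theorem ar_mul_e (a : A) : G.ar a * G.e (G.Q.tl a) = G.ar a := by
  have h := RingQuot.mkAlgHom_rel k (QuiverRel.PathRel.tail (Q := G.Q) (k := k) a)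
  simpa only [map_mul, e, ar, QuiverRel.triv, QuiverRel.arrow] using congrArg G.proj h

theorem e_mul_ar_of_ne {v : V} {a : A} (h : v ≠ G.Q.hd a) : G.e v * G.ar a = 0 := by
  rw [← G.e_mul_ar a, ← mul_assoc, G.e_mul_e_of_ne h, zero_mul]

theorem word_nil : G.word [] = 1 := by
  simp [word, QuiverRel.pathProd]

end Generators

/-! ### The representation of `Λ` on paths -/

/-- The path `a p`, where a path is given by its tail and its list of arrows. -/
def consPath {V A : Type*} (a : A) (p : V × List A) : V × List A := (p.1, a :: p.2)

theorem consPath_injective {V A : Type*} (a : A) :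
    Function.Injective (consPath a : V × List A → V × List A) := by
  rintro ⟨v, p⟩ ⟨w, q⟩ h
  simpa [consPath] using h

section Paths

variable {k V A : Type u} [Field k] [Fintype V] [Fintype A] (G : GentleData k V A)

/-- The product `a b` of two arrows is a path which does not lie in `𝓙`. -/
def Composable (a b : A) : Prop :=
  G.Q.tl a = G.Q.hd b ∧ G.Q.arrow k a * G.Q.arrow k b ∉ G.Q.ideal k

/-- The head of the path given by its tail and its list of arrows. -/
def pathHd : V × List A → V
  | (v, []) => v
  | (_, a :: _) => G.Q.hd a

/-- The arrow `a` can be put in front of a path, given by its tail and its list of arrows, so that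
the new pair of consecutive arrows is not in `𝓙`. -/
def CanCons (a : A) : V × List A → Prop
  | (v, []) => G.Q.tl a = v
  | (_, b :: _) => G.Composable a b

variable {G} in
theorem CanCons.tl_eq {a : A} {p : V × List A} (h : G.CanCons a p) : G.Q.tl a = G.pathHd p := by
  rcases p with ⟨v, _ | ⟨b, p⟩⟩
  · exact h
  · exact h.1

open Classical in
/-- Multiplication by `e_v` on the vector space with basis the paths. -/
def trivAct (v : V) : Module.End k (V × List A →₀ k) where
  toFun w := w.filter (G.pathHd · = v)
  map_add' _ _ := Finsupp.filter_add
  map_smul' _ _ := Finsupp.filter_smul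

open Classical in
/-- Multiplication by the arrow `a` on the vector space with basis the paths, where products that
are not paths outside `𝓙` are set to zero. -/
def arrowAct (a : A) : Module.End k (V × List A →₀ k) where
  toFun w := (w.filter (G.CanCons a)).mapDomain (consPath a)
  map_add' _ _ := by rw [Finsupp.filter_add, Finsupp.mapDomain_add]
  map_smul' _ _ := by rw [Finsupp.filter_smul, Finsupp.mapDomain_smul, RingHom.id_apply]

variable {G}

theorem trivAct_of {v : V} {p : V × List A} (h : G.pathHd p = v) (c : k) :
    G.trivAct v (Finsupp.single p c) = Finsupp.single p c := by
  classical
  exact Finsupp.filter_single_of_pos _ h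

theorem trivAct_of_ne {v : V} {p : V × List A} (h : G.pathHd p ≠ v) (c : k) :
    G.trivAct v (Finsupp.single p c) = 0 := by
  classical
  exact Finsupp.filter_single_of_neg _ h

theorem arrowAct_of {a : A} {p : V × List A} (h : G.CanCons a p) (c : k) :
    G.arrowAct a (Finsupp.single p c) = Finsupp.single (consPath a p) c := by
  classical
  exact (congrArg _ (Finsupp.filter_single_of_pos _ h)).trans Finsupp.mapDomain_single

theorem arrowAct_of_not {a : A} {p : V × List A} (h : ¬ G.CanCons a p) (c : k) :
    G.arrowAct a (Finsupp.single p c) = 0 := by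
  classical
  exact (congrArg _ (Finsupp.filter_single_of_neg _ h)).trans Finsupp.mapDomain_zero

theorem arrowAct_apply_of_ne {a : A} (w : V × List A →₀ k) {p : V × List A}
    (h : p.2.head? ≠ some a) : G.arrowAct a w p = 0 := by
  refine Finsupp.mapDomain_of_notMem_range _ _ ?_
  rintro ⟨q, rfl⟩
  exact h rfl

theorem arrowAct_apply_consPath {a : A} (w : V × List A →₀ k) {p : V × List A}
    (h : G.CanCons a p) : G.arrowAct a w (consPath a p) = w p := by
  classical
  exact (Finsupp.mapDomain_apply (consPath_injective a) _ p).trans (Finsupp.filter_apply_pos _ _ h)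

theorem trivAct_mul_trivAct_self (v : V) : G.trivAct v * G.trivAct v = G.trivAct v := by
  refine Finsupp.lhom_ext fun p c => ?_
  rw [Module.End.mul_apply]
  by_cases h : G.pathHd p = v
  · rw [trivAct_of h, trivAct_of h]
  · rw [trivAct_of_ne h, map_zero]

theorem trivAct_mul_trivAct_of_ne {v w : V} (hvw : v ≠ w) : G.trivAct v * G.trivAct w = 0 := by
  refine Finsupp.lhom_ext fun p c => ?_
  rw [Module.End.mul_apply, LinearMap.zero_apply]
  by_cases h : G.pathHd p = w
  · rw [trivAct_of h, trivAct_of_ne (h.trans_ne hvw.symm)]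
  · rw [trivAct_of_ne h, map_zero]

theorem sum_trivAct : ∑ v, G.trivAct v = 1 := by
  refine Finsupp.lhom_ext fun p c => ?_
  rw [LinearMap.sum_apply, Finset.sum_eq_single (G.pathHd p), trivAct_of rfl, Module.End.one_apply]
  · exact fun w _ h => trivAct_of_ne h.symm c
  · exact fun h => absurd (Finset.mem_univ _) h

theorem trivAct_mul_arrowAct (a : A) : G.trivAct (G.Q.hd a) * G.arrowAct a = G.arrowAct a := by
  refine Finsupp.lhom_ext fun p c => ?_
  rw [Module.End.mul_apply]
  by_cases h : G.CanCons a p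
  · rw [arrowAct_of h]
    exact trivAct_of (p := consPath a p) rfl c
  · rw [arrowAct_of_not h, map_zero]

theorem arrowAct_mul_trivAct (a : A) : G.arrowAct a * G.trivAct (G.Q.tl a) = G.arrowAct a := by
  refine Finsupp.lhom_ext fun p c => ?_
  rw [Module.End.mul_apply]
  by_cases h : G.pathHd p = G.Q.tl a
  · rw [trivAct_of h]
  · rw [trivAct_of_ne h, map_zero, arrowAct_of_not fun h' => h h'.tl_eq.symm]

theorem arrowAct_mul_arrowAct {a b : A} (h : G.Q.arrow k a * G.Q.arrow k b ∈ G.Q.ideal k) :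
    G.arrowAct a * G.arrowAct b = 0 := by
  refine Finsupp.lhom_ext fun p c => ?_
  rw [Module.End.mul_apply, LinearMap.zero_apply]
  by_cases hb : G.CanCons b p
  · have hab : ¬ G.CanCons a (consPath b p) := fun h' : G.Composable a b => h'.2 h
    rw [arrowAct_of hb, arrowAct_of_not hab]
  · rw [arrowAct_of_not hb, map_zero]

variable (G)

/-- The action of `kQ` on the vector space with basis the paths. -/
def pathAlgebraRep : G.Q.PathAlgebra k →ₐ[k] Module.End k (V × List A →₀ k) :=
  RingQuot.liftAlgHom k ⟨FreeAlgebra.lift k (Sum.elim G.trivAct G.arrowAct), by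
    rintro _ _ (v | ⟨v, w, hvw⟩ | _ | a | a) <;>
      simp only [map_mul, map_sum, map_zero, map_one, FreeAlgebra.lift_ι_apply, Sum.elim_inl,
        Sum.elim_inr]
    · exact trivAct_mul_trivAct_self v
    · exact trivAct_mul_trivAct_of_ne hvw
    · exact sum_trivAct
    · exact trivAct_mul_arrowAct a
    · exact arrowAct_mul_trivAct a⟩

theorem pathAlgebraRep_arrow (a : A) : G.pathAlgebraRep (G.Q.arrow k a) = G.arrowAct a := by
  simp [pathAlgebraRep, QuiverRel.arrow]

theorem ideal_le_ker_pathAlgebraRep : G.Q.ideal k ≤ TwoSidedIdeal.ker G.pathAlgebraRep := by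
  intro z hz
  refine TwoSidedIdeal.mem_span_iff.1 hz _ ?_
  rintro _ ⟨⟨a, b⟩, hp, rfl⟩
  rw [SetLike.mem_coe, TwoSidedIdeal.mem_ker, map_mul, pathAlgebraRep_arrow, pathAlgebraRep_arrow]
  exact arrowAct_mul_arrowAct (TwoSidedIdeal.subset_span ⟨(a, b), hp, rfl⟩)

/-- The action of `Λ` on the vector space with basis the paths. -/
def rep : G.Alg →+* Module.End k (V × List A →₀ k) :=
  (G.Q.ideal k).ringCon.lift (G.pathAlgebraRep : G.Q.PathAlgebra k →+* _) fun _ _ h =>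
    (TwoSidedIdeal.ker_ringCon _).1
      (TwoSidedIdeal.ringCon_le_iff.1 G.ideal_le_ker_pathAlgebraRep h)

theorem rep_algebraMap (c : k) : G.rep (algebraMap k G.Alg c) = algebraMap k _ c :=
  G.pathAlgebraRep.commutes c

theorem rep_e (v : V) : G.rep (G.e v) = G.trivAct v := by
  change G.pathAlgebraRep (G.Q.triv k v) = _
  simp [pathAlgebraRep, QuiverRel.triv]

theorem rep_ar (a : A) : G.rep (G.ar a) = G.arrowAct a := G.pathAlgebraRep_arrow a

/-- The element of `Λ` given by a path. -/
def pathVal (p : V × List A) : G.Alg := G.word p.2 * G.e p.1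

theorem e_mul_pathVal (p : V × List A) : G.e (G.pathHd p) * G.pathVal p = G.pathVal p := by
  rcases p with ⟨v, _ | ⟨a, p⟩⟩
  · rw [pathVal, word_nil, one_mul, pathHd, triv_idem]
  · rw [pathVal, pathHd, word_cons, ← mul_assoc, ← mul_assoc, e_mul_ar]

theorem ar_mul_pathVal (a : A) (p : V × List A) :
    G.ar a * G.pathVal p = G.pathVal (consPath a p) := by
  rw [pathVal, pathVal, consPath, word_cons, mul_assoc]

variable {G} in
theorem ar_mul_pathVal_of_not_canCons {a : A} {p : V × List A} (h : ¬ G.CanCons a p) :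
    G.ar a * G.pathVal p = 0 := by
  by_cases ht : G.Q.tl a = G.pathHd p
  · rcases p with ⟨v, _ | ⟨b, p⟩⟩
    · exact absurd ht h
    · rw [pathVal, word_cons, ← mul_assoc, ← mul_assoc,
        ar_mul_ar G (not_not.1 fun hb => h ⟨ht, hb⟩), zero_mul, zero_mul]
  · rw [← G.ar_mul_e, ← G.e_mul_pathVal, ← mul_assoc, mul_assoc (G.ar a), G.e_mul_e_of_ne ht,
      mul_zero, zero_mul]

/-- The element of `Λ` given by a linear combination of paths. -/
def evalPaths : (V × List A →₀ k) →ₗ[k] G.Alg := Finsupp.linearCombination k G.pathVal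

theorem evalPaths_rep (x : G.Alg) :
    G.evalPaths ∘ₗ G.rep x = LinearMap.mulLeft k x ∘ₗ G.evalPaths := by
  induction x using G.alg_induction with
  | algebraMap c =>
    refine Finsupp.lhom_ext fun p d => ?_
    rw [LinearMap.comp_apply, LinearMap.comp_apply, rep_algebraMap, Module.algebraMap_end_apply,
      map_smul, LinearMap.mulLeft_apply, Algebra.smul_def]
  | e v =>
    refine Finsupp.lhom_ext fun p d => ?_
    rw [LinearMap.comp_apply, LinearMap.comp_apply, rep_e, LinearMap.mulLeft_apply]
    by_cases h : G.pathHd p = v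
    · rw [trivAct_of h, evalPaths, Finsupp.linearCombination_single, mul_smul_comm, ← h,
        e_mul_pathVal]
    · rw [trivAct_of_ne h, map_zero, evalPaths, Finsupp.linearCombination_single,
        mul_smul_comm, ← G.e_mul_pathVal, ← mul_assoc, G.e_mul_e_of_ne (Ne.symm h), zero_mul,
        smul_zero]
  | ar a =>
    refine Finsupp.lhom_ext fun p d => ?_
    rw [LinearMap.comp_apply, LinearMap.comp_apply, rep_ar, LinearMap.mulLeft_apply]
    by_cases h : G.CanCons a p
    · simp [arrowAct_of h, evalPaths, ar_mul_pathVal]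
    · simp [arrowAct_of_not h, evalPaths, ar_mul_pathVal_of_not_canCons h]
  | add x y hx hy =>
    rw [map_add, LinearMap.comp_add, hx, hy]
    exact LinearMap.ext fun w => (add_mul x y (G.evalPaths w)).symm
  | mul x y hx hy =>
    rw [map_mul, Module.End.mul_eq_comp, ← LinearMap.comp_assoc, hx, LinearMap.comp_assoc, hy,
      LinearMap.mulLeft_mul, LinearMap.comp_assoc]

theorem eq_zero_of_rep {x : G.Alg} (h : ∀ w, G.rep x w = 0) : x = 0 := by
  have hone : G.evalPaths (∑ v, Finsupp.single (v, []) 1) = 1 := by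
    simp [evalPaths, pathVal, word_nil, sum_e]
  have hx := LinearMap.congr_fun (G.evalPaths_rep x) (∑ v, Finsupp.single (v, []) 1)
  rw [LinearMap.comp_apply, LinearMap.comp_apply, h, map_zero, hone] at hx
  simpa using hx.symm

variable {G}

theorem arrow_not_mem (a : A) : G.Q.arrow k a ∉ G.Q.ideal k := by
  intro h
  have hzero : G.arrowAct a = 0 := by
    rw [← G.pathAlgebraRep_arrow]
    exact (TwoSidedIdeal.mem_ker _).1 (G.ideal_le_ker_pathAlgebraRep h)
  have hsingle := arrowAct_of (G := G) (show G.CanCons a (G.Q.tl a, []) from rfl) 1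
  rw [hzero, LinearMap.zero_apply, eq_comm, Finsupp.single_eq_zero] at hsingle
  exact one_ne_zero hsingle

theorem ar_mul_eq_zero_of_sum {s : Finset A} {c : A → G.Alg} (h : ∑ b ∈ s, G.ar b * c b = 0)
    {a : A} (ha : a ∈ s) : G.ar a * c a = 0 := by
  refine G.eq_zero_of_rep fun w => Finsupp.ext fun p => ?_
  have hsum : ∑ b ∈ s, G.arrowAct b (G.rep (c b) w) p = 0 := by
    simpa [rep_ar, Finsupp.finsetSum_apply] using
      DFunLike.congr_fun (LinearMap.congr_fun (congrArg G.rep h) w) p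
  rw [map_mul, Module.End.mul_apply, rep_ar, Finsupp.zero_apply]
  by_cases hp : p.2.head? = some a
  · rwa [Finset.sum_eq_single_of_mem a ha] at hsum
    exact fun b _ hb => arrowAct_apply_of_ne _ fun hb' => hb (Option.some.inj (hb'.symm.trans hp))
  · exact arrowAct_apply_of_ne _ hp

theorem ar_mul_cancel {a b : A} (hab : G.Composable a b) {x : G.Alg}
    (h : G.ar a * (G.ar b * x) = 0) : G.ar b * x = 0 := by
  refine G.eq_zero_of_rep fun w => Finsupp.ext fun p => ?_
  rw [map_mul, Module.End.mul_apply, rep_ar, Finsupp.zero_apply]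
  by_cases hp : p.2.head? = some b
  · have hcons : G.CanCons a p := by
      rcases p with ⟨v, _ | ⟨c, p⟩⟩
      · cases hp
      · cases hp
        exact hab
    have hval := DFunLike.congr_fun (LinearMap.congr_fun (congrArg G.rep h) w) (consPath a p)
    rwa [map_mul, map_mul, Module.End.mul_apply, Module.End.mul_apply, rep_ar, rep_ar,
      arrowAct_apply_consPath _ hcons, map_zero] at hval
  · exact arrowAct_apply_of_ne _ hp

end Paths

variable {k V A : Type u} [Field k] [Fintype V] [Fintype A] {G : GentleData k V A}

/-! ### Arrows acting on modules -/

section Modules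

variable {T : Type*} [AddCommGroup T] [Module G.Alg T]

theorem ar_smul_eq_zero_of_sum (hT : IsTorsionless G.Alg T) {s : Finset A} {c : A → T}
    (h : ∑ b ∈ s, G.ar b • c b = 0) {a : A} (ha : a ∈ s) : G.ar a • c a = 0 := by
  refine hT _ fun φ => ?_
  have hφ : ∑ b ∈ s, G.ar b * φ (c b) = 0 := by
    simpa only [map_sum, map_smul, smul_eq_mul, map_zero] using congrArg φ h
  rw [map_smul, smul_eq_mul]
  exact ar_mul_eq_zero_of_sum hφ ha

theorem ar_smul_cancel (hT : IsTorsionless G.Alg T) {a b : A} (hab : G.Composable a b) {x : T}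
    (h : G.ar a • G.ar b • x = 0) : G.ar b • x = 0 := by
  refine hT _ fun φ => ?_
  have hφ : G.ar a * (G.ar b * φ x) = 0 := by
    simpa only [map_smul, smul_eq_mul, map_zero] using congrArg φ h
  rw [map_smul, smul_eq_mul]
  exact ar_mul_cancel hab hφ

theorem word_smul_cancel (hT : IsTorsionless G.Alg T) {p : List A} {b : A}
    (hp : (p ++ [b]).IsChain G.Composable) {x : T} (h : G.word p • G.ar b • x = 0) :
    G.ar b • x = 0 := by
  induction p with
  | nil => simpa only [word_nil, one_smul] using h
  | cons a p ih =>
    refine ih hp.tail ?_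
    rw [word_cons, mul_smul] at h
    cases p with
    | nil =>
      rw [word_nil, one_smul] at h ⊢
      exact ar_smul_cancel hT (List.isChain_cons_cons.1 hp).1 h
    | cons a' p =>
      rw [word_cons, mul_smul] at h ⊢
      exact ar_smul_cancel hT (List.isChain_cons_cons.1 hp).1 h

theorem isChain_composable {p : List A} (hp : G.Q.IsPath p)
    (hn : G.Q.pathProd k p ∉ G.Q.ideal k) : p.IsChain G.Composable := by
  induction p with
  | nil => exact List.isChain_nil
  | cons a p ih =>
    cases p with
    | nil => exact List.isChain_singleton a
    | cons b p =>
      have hprod : G.Q.pathProd k (a :: b :: p) = G.Q.arrow k a * G.Q.pathProd k (b :: p) ∧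
          G.Q.pathProd k (a :: b :: p) = G.Q.arrow k a * G.Q.arrow k b * G.Q.pathProd k p := by
        simp [QuiverRel.pathProd, mul_assoc]
      rw [QuiverRel.IsPath, List.isChain_cons_cons] at hp
      refine List.isChain_cons_cons.2 ⟨⟨hp.1, fun h => hn ?_⟩, ih hp.2 fun h => hn ?_⟩
      · rw [hprod.2]
        exact TwoSidedIdeal.mul_mem_right _ _ _ h
      · rw [hprod.1]
        exact TwoSidedIdeal.mul_mem_left _ _ _ h

theorem NzPath.val_smul_cancel (hT : IsTorsionless G.Alg T) (γ : G.NzPath) {b : A}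
    (hb : G.Composable γ.first b) {x : T} (h : γ.val • G.ar b • x = 0) : G.ar b • x = 0 := by
  refine word_smul_cancel hT ?_ h
  refine (isChain_composable γ.isPath γ.not_mem).append (List.isChain_singleton b) ?_
  intro a ha c hc
  rw [List.getLast?_eq_some_getLast γ.ne_nil, Option.mem_some_iff] at ha
  cases ha
  cases hc
  exact hb

variable (G T) in
/-- The submodule `𝔯 T`, with `𝔯` the ideal of `Λ` generated by the arrows. -/
def arrowSpan : Submodule G.Alg T where
  carrier := {x | ∃ c : A → T, ∑ b, G.ar b • c b = x}
  zero_mem' := ⟨0, by simp⟩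
  add_mem' := by
    rintro _ _ ⟨c, rfl⟩ ⟨c', rfl⟩
    exact ⟨c + c', by simp [smul_add, Finset.sum_add_distrib]⟩
  smul_mem' r := by
    classical
    induction r using G.alg_induction with
    | algebraMap t =>
      rintro _ ⟨c, rfl⟩
      refine ⟨fun b => algebraMap k G.Alg t • c b, ?_⟩
      simp only [Finset.smul_sum, smul_smul, Algebra.commutes]
    | e w =>
      rintro _ ⟨c, rfl⟩
      refine ⟨fun b => if w = G.Q.hd b then c b else 0, ?_⟩
      rw [Finset.smul_sum]
      refine Finset.sum_congr rfl fun b _ => ?_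
      dsimp only
      by_cases h : w = G.Q.hd b
      · rw [if_pos h, h, smul_smul, e_mul_ar]
      · rw [if_neg h, smul_zero, smul_smul, e_mul_ar_of_ne G h, zero_smul]
    | ar a => exact fun {x} _ => ⟨Pi.single a x, by simp [Pi.single_apply]⟩
    | add r r' hr hr' =>
      intro x hx
      obtain ⟨c, hc⟩ := hr hx
      obtain ⟨c', hc'⟩ := hr' hx
      exact ⟨c + c', by simp [add_smul, smul_add, hc, hc', Finset.sum_add_distrib]⟩
    | mul r r' hr hr' =>
      intro x hx
      rw [mul_smul]
      exact hr (hr' hx)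

theorem ar_smul_mem_arrowSpan (a : A) (y : T) : G.ar a • y ∈ arrowSpan G T := by
  classical
  exact ⟨Pi.single a y, by simp [Pi.single_apply]⟩

theorem map_mem_arrowSpan {T' : Type*} [AddCommGroup T'] [Module G.Alg T'] (f : T →ₗ[G.Alg] T')
    {x : T} (hx : x ∈ arrowSpan G T) : f x ∈ arrowSpan G T' := by
  obtain ⟨c, rfl⟩ := hx
  exact ⟨f ∘ c, by simp⟩

open Classical in
theorem exists_sum_of_mem_arrowSpan {v : V} {x : T} (hx : x ∈ arrowSpan G T)
    (hv : G.e v • x = x) :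
    ∃ c : A → T, x = ∑ b ∈ Finset.univ.filter (fun b => G.Q.hd b = v), G.ar b • c b := by
  obtain ⟨c, rfl⟩ := hx
  refine ⟨c, ?_⟩
  rw [← hv, Finset.smul_sum, Finset.sum_filter]
  refine Finset.sum_congr rfl fun b _ => ?_
  split_ifs with h
  · rw [← h, smul_smul, e_mul_ar]
  · rw [smul_smul, e_mul_ar_of_ne G (Ne.symm h), zero_smul]

theorem exists_smul_mk_eq (x : G.Alg) (v : V) (t : T) :
    ∃ c : k, x • (arrowSpan G T).mkQ (G.e v • t) =
      algebraMap k G.Alg c • (arrowSpan G T).mkQ (G.e v • t) := by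
  induction x using G.alg_induction with
  | algebraMap c => exact ⟨c, rfl⟩
  | e w =>
    rw [← map_smul, smul_smul]
    rcases eq_or_ne w v with rfl | h
    · exact ⟨1, by rw [triv_idem, map_one, one_smul]⟩
    · exact ⟨0, by rw [G.e_mul_e_of_ne h, zero_smul, map_zero, map_zero, zero_smul]⟩
  | ar a =>
    refine ⟨0, ?_⟩
    rw [← map_smul, map_zero, zero_smul]
    exact (Submodule.Quotient.mk_eq_zero _).2 (ar_smul_mem_arrowSpan a _)
  | add x y hx hy =>
    obtain ⟨c, hc⟩ := hx
    obtain ⟨d, hd⟩ := hy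
    exact ⟨c + d, by rw [add_smul, hc, hd, map_add, add_smul]⟩
  | mul x y hx hy =>
    obtain ⟨c, hc⟩ := hx
    obtain ⟨d, hd⟩ := hy
    exact ⟨d * c, by rw [mul_smul, hd, ← mul_smul, ← Algebra.commutes, mul_smul, hc, map_mul,
      mul_smul]⟩

theorem isSemisimpleModule_quotient_arrowSpan :
    IsSemisimpleModule G.Alg (T ⧸ arrowSpan G T) := by
  refine isSemisimpleModule_of_isSemisimpleModule_submodule'
    (p := fun q : V × T => Submodule.span G.Alg {(arrowSpan G T).mkQ (G.e q.1 • q.2)})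
    (fun q => isSemisimpleModule_span_singleton fun x => exists_smul_mk_eq x q.1 q.2) ?_
  refine eq_top_iff.2 fun y _ => ?_
  obtain ⟨t, rfl⟩ := (arrowSpan G T).mkQ_surjective y
  rw [← one_smul G.Alg t, ← sum_e, Finset.sum_smul, map_sum]
  exact Submodule.sum_mem _ fun v _ =>
    Submodule.mem_iSup_of_mem (v, t) (Submodule.mem_span_singleton_self _)

theorem jacobson_le_arrowSpan : Module.jacobson G.Alg T ≤ arrowSpan G T :=
  have := isSemisimpleModule_quotient_arrowSpan (G := G) (T := T)
  Module.jacobson_le_of_eq_bot (IsSemisimpleModule.jacobson_eq_bot _ _)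

end Modules

/-! ### Signs at the places of `C(↙↘)` -/

section Places

theorem Letter.flip_flip (x : G.Letter) : x.flip.flip = x := by cases x <;> rfl

variable (G) in
/-- An arrow, as an element of `𝐏`. -/
def arrowPath (a : A) : G.NzPath :=
  ⟨[a], by simp, List.isChain_singleton _, by
    simpa [QuiverRel.pathProd] using G.arrow_not_mem a⟩

/-- If the letter `o` exists, it has head `v` and sign `ε`; if not, then no inverse of an arrow has
head `v` and sign `ε`. In the second case a word whose inverse has head `v` and sign `-ε` cannot be
extended by the inverse of an arrow. -/
structure IsMaximalAt (v : V) (ε : ℤˣ) (o : Option G.Letter) : Prop where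
  hd_eq : ∀ x ∈ o, x.hd = v
  sgn_eq : ∀ x ∈ o, x.sgn = ε
  eq_none : o = none → ∀ y : G.Letter, y.IsInvArrow → y.hd = v → y.sgn ≠ ε

theorem isMaximalAt_some (x : G.Letter) : IsMaximalAt x.hd x.sgn (some x) where
  hd_eq := by rintro _ ⟨⟩; rfl
  sgn_eq := by rintro _ ⟨⟩; rfl
  eq_none h := by cases h

theorem isMaximalAt_of_eq_some_iff {v : V} {ε : ℤˣ} {o : Option G.Letter}
    (h : ∀ y, o = some y ↔ y.IsInvArrow ∧ y.hd = v ∧ y.sgn = ε) : IsMaximalAt v ε o where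
  hd_eq x hx := ((h x).1 hx).2.1
  sgn_eq x hx := ((h x).1 hx).2.2
  eq_none ho y hy hv hs := by
    have hoy := (h y).2 ⟨hy, hv, hs⟩
    rw [ho] at hoy
    cases hoy

theorem isMaximalAt_nextInv (x : G.Letter) :
    IsMaximalAt x.tl (-x.flip.sgn) (G.nextInv x) := by
  refine isMaximalAt_of_eq_some_iff fun y => ?_
  rw [nextInv_eq_some, Letter.adj_iff, eq_comm (a := x.tl)]

theorem map_flip_eq_some {o : Option G.Letter} {y : G.Letter} :
    o.map Letter.flip = some y ↔ o = some y.flip := by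
  rcases o with _ | x
  · simp
  · rw [Option.map_some, Option.some_inj, Option.some_inj]
    exact ⟨fun h => by rw [← h, Letter.flip_flip], fun h => by rw [h, Letter.flip_flip]⟩

theorem isMaximalAt_prevDir (x : G.Letter) :
    IsMaximalAt x.hd (-x.sgn) ((G.prevDir x).map Letter.flip) := by
  refine isMaximalAt_of_eq_some_iff fun y => ?_
  rw [map_flip_eq_some, prevDir_eq_some, Letter.adj_iff, ← Letter.isInvArrow_flip,
    ← Letter.flip_hd, Letter.flip_flip, eq_comm (b := -_), neg_eq_iff_eq_neg]

namespace FinWord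

variable {v : V} {δ : ℤˣ} (C : G.FinWord v δ)

theorem isMaximalAt_startRight : IsMaximalAt C.endVert (-C.endSgn) C.startRight := by
  refine isMaximalAt_of_eq_some_iff fun y => ?_
  rw [startRight_eq_some, eq_comm (a := C.endVert), eq_comm (b := -_), neg_eq_iff_eq_neg]

variable (G v δ) in
theorem isMaximalAt_startLeft : IsMaximalAt v (-δ) ((startLeft G v δ).map Letter.flip) := by
  refine isMaximalAt_of_eq_some_iff fun y => ?_
  rw [map_flip_eq_some, startLeft_eq_some, ← Letter.isInvArrow_flip, ← Letter.flip_hd,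
    Letter.flip_flip]

theorem isMaximalAt_right_zero : IsMaximalAt v δ (C.right 0) := by
  rcases C with ⟨_ | ⟨x, L⟩, hchain, hstart⟩
  · simpa [endVert, endSgn, right, iterOpt] using
      isMaximalAt_startRight (⟨[], hchain, hstart⟩ : G.FinWord v δ)
  · obtain ⟨rfl, rfl⟩ := hstart x rfl
    exact isMaximalAt_some x

theorem isMaximalAt_right_succ {n : ℕ} {x : G.Letter} (hx : C.right n = some x) :
    IsMaximalAt x.tl (-x.flip.sgn) (C.right (n + 1)) := by
  rcases lt_trichotomy (n + 1) C.letters.length with hn | hn | hn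
  · obtain ⟨htl, hsgn⟩ := (Letter.adj_iff _ _).1 (C.right_adj hx (C.right_of_lt hn))
    rw [C.right_of_lt hn, htl, ← hsgn]
    exact isMaximalAt_some _
  · have hlast : C.letters.getLast? = some x := by
      rw [List.getLast?_eq_getElem?, ← hn, Nat.add_sub_cancel,
        List.getElem?_eq_getElem (by lia), ← C.right_of_lt (by lia), hx]
    rw [C.right_of_ge hn.ge, hn, Nat.sub_self]
    simpa [endVert, endSgn, hlast, iterOpt] using C.isMaximalAt_startRight
  · rw [C.right_of_ge (by lia)] at hx
    rw [C.right_of_ge hn.le, Nat.sub_add_comm (by lia), iterOpt, hx]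
    exact isMaximalAt_nextInv x

theorem isMaximalAt_left_succ {n : ℕ} {x : G.Letter} (hx : left G v δ n = some x) :
    IsMaximalAt x.hd (-x.sgn) ((left G v δ (n + 1)).map Letter.flip) := by
  rw [left] at hx
  rw [left, iterOpt, hx]
  exact isMaximalAt_prevDir x

theorem exists_isMaximalAt {i : ℤ} (hi : i ∈ C.ext.index) : ∃ ε : ℤˣ,
    IsMaximalAt (C.ext.vert i) ε (C.ext.letter (i + 1)) ∧
      IsMaximalAt (C.ext.vert i) (-ε) ((C.ext.letter i).map Letter.flip) := by
  change ∃ ε, IsMaximalAt _ ε (C.extLetter (i + 1)) ∧ IsMaximalAt _ (-ε) ((C.extLetter i).map _)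
  rcases lt_trichotomy 0 i with h | rfl | h
  · obtain ⟨x, hx⟩ := Option.isSome_iff_exists.1 (hi.1 h)
    have hright : C.right (i - 1).toNat = some x := (C.extLetter_of_pos h).symm.trans hx
    refine ⟨-x.flip.sgn, ?_, ?_⟩
    · rw [(C.ext.vert_of_letter hx).1, C.extLetter_of_pos (by lia),
        show (i + 1 - 1).toNat = (i - 1).toNat + 1 by lia]
      exact C.isMaximalAt_right_succ hright
    · rw [(C.ext.vert_of_letter hx).1, neg_neg, show C.extLetter i = _ from hx, ← Letter.flip_hd]
      exact isMaximalAt_some x.flip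
  · exact ⟨δ, C.isMaximalAt_right_zero, isMaximalAt_startLeft G v δ⟩
  · obtain ⟨x, hx⟩ := Option.isSome_iff_exists.1 (hi.2 h)
    have hleft : left G v δ (-(i + 1)).toNat = some x :=
      (C.extLetter_of_le (by lia)).symm.trans hx
    have hv := (C.ext.vert_of_letter hx).2.1
    rw [add_sub_cancel_right] at hv
    refine ⟨x.sgn, ?_, ?_⟩
    · rw [hv, show C.extLetter (i + 1) = _ from hx]
      exact isMaximalAt_some x
    · rw [hv, C.extLetter_of_le h.le, show (-i).toNat = (-(i + 1)).toNat + 1 by lia]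
      exact isMaximalAt_left_succ hleft

end FinWord

end Places

variable {M : CochainComplex (ModuleCat.{u} G.Alg) ℤ}

/-! ### The differential at a place -/

section Differential

variable (M) in
/-- `M` is homotopically minimal with torsionless terms. For the radical we take the ideal generated
by the arrows. -/
structure IsMinimalTorsionless : Prop where
  torsionless : ∀ n, IsTorsionless G.Alg (M.X n)
  minimal : ∀ n, LinearMap.range (M.d n (n + 1)).hom ≤ arrowSpan G (M.X (n + 1))

theorem IsMinimalProj.isMinimalTorsionless (hM : IsMinimalProj M) : IsMinimalTorsionless M where
  torsionless n := isTorsionless_of_projective G.Alg (M.X n) (h := hM.projective n)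
  minimal n := (hM.minimal n).trans jacobson_le_arrowSpan

theorem totalD_lof (i : ℤ) (x : M.X i) :
    totalD M (DirectSum.lof G.Alg ℤ (fun i => M.X i) i x) =
      DirectSum.lof G.Alg ℤ (fun i => M.X i) (i + 1) (M.d i (i + 1) x) := by
  simp [totalD]

theorem totalD_totalD (x : Total M) : totalD M (totalD M x) = 0 := by
  refine DirectSum.induction_on x (by simp) (fun i x => ?_) fun x y hx hy => by
    rw [map_add, map_add, hx, hy, add_zero]
  have hdd : M.d (i + 1) (i + 1 + 1) (M.d i (i + 1) x) = 0 :=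
    congrArg (fun f => f.hom x) (M.d_comp_d i (i + 1) (i + 1 + 1))
  exact (congrArg (totalD M) (totalD_lof i x)).trans (by rw [totalD_lof, hdd, map_zero])

theorem component_totalD (i : ℤ) (x : Total M) :
    DirectSum.component G.Alg ℤ (fun i => M.X i) (i + 1) (totalD M x) =
      M.d i (i + 1) (DirectSum.component G.Alg ℤ (fun i => M.X i) i x) := by
  refine DirectSum.induction_on x (by simp) (fun j x => ?_) fun x y hx hy => by
    simp only [map_add, hx, hy]
  change DirectSum.component G.Alg ℤ (fun i => M.X i) (i + 1)
      (totalD M (DirectSum.lof G.Alg ℤ (fun i => M.X i) j x)) =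
    M.d i (i + 1) (DirectSum.component G.Alg ℤ (fun i => M.X i) i
      (DirectSum.lof G.Alg ℤ (fun i => M.X i) j x))
  rw [totalD_lof]
  rcases eq_or_ne j i with rfl | h
  · rw [DirectSum.component.lof_self, DirectSum.component.lof_self]
  · rw [DirectSum.component.of, dif_neg (by lia), DirectSum.component.of, dif_neg h, map_zero]

namespace IsMinimalTorsionless

theorem total (hM : IsMinimalTorsionless M) : IsTorsionless G.Alg (Total M) :=
  IsTorsionless.directSum hM.torsionless

theorem totalD_mem_arrowSpan (hM : IsMinimalTorsionless M) (x : Total M) :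
    totalD M x ∈ arrowSpan G (Total M) := by
  refine DirectSum.induction_on x (by simp) (fun i x => ?_) fun x y hx hy => by
    rw [map_add]
    exact Submodule.add_mem _ hx hy
  exact (totalD_lof i x).symm ▸ map_mem_arrowSpan _ (hM.minimal i ⟨x, rfl⟩)

open Classical in
theorem exists_totalD_eq_sum (hM : IsMinimalTorsionless M) {v : V} {m : Total M}
    (hm : m ∈ vertexPart M v) :
    ∃ c : A → Total M,
      totalD M m = ∑ b ∈ Finset.univ.filter (fun b => G.Q.hd b = v), G.ar b • c b :=
  exists_sum_of_mem_arrowSpan (hM.totalD_mem_arrowSpan m)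
    (by rw [← map_smul, show G.e v • m = m from hm])

end IsMinimalTorsionless

namespace IsArrowD

variable {α : A} {m y : Total M}

theorem totalD_eq_zero (hT : IsTorsionless G.Alg (Total M)) (h : IsArrowD M α m y) :
    totalD M y = 0 := by
  obtain ⟨-, c, hc, rfl⟩ := h
  have hdd := totalD_totalD m
  simp only [hc, map_sum, map_smul] at hdd
  rw [map_smul]
  exact ar_smul_eq_zero_of_sum hT hdd (by simp)

open Classical in
theorem eq_ar_smul (hT : IsTorsionless G.Alg (Total M)) (h : IsArrowD M α m y) {c : A → Total M}
    (hc : totalD M m =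
      ∑ b ∈ Finset.univ.filter (fun b => G.Q.hd b = G.Q.hd α), G.ar b • c b) :
    y = G.ar α • c α := by
  obtain ⟨-, c', hc', rfl⟩ := h
  have hsum : ∑ b ∈ Finset.univ.filter (fun b => G.Q.hd b = G.Q.hd α),
      G.ar b • (c' b - c b) = 0 := by
    simp only [smul_sub, Finset.sum_sub_distrib]
    rw [← hc, ← hc', sub_self]
  rw [← sub_eq_zero, ← smul_sub]
  exact ar_smul_eq_zero_of_sum hT hsum (by simp)

end IsArrowD

theorem arrowPath_val (a : A) : (G.arrowPath a).val = G.ar a := by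
  simp [arrowPath, NzPath.val, word_cons, word_nil]

theorem NzPath.IsArrow.eq_arrowPath {γ : G.NzPath} (h : γ.IsArrow) : γ = G.arrowPath γ.last := by
  rcases γ with ⟨p, hne, hp, hn⟩
  obtain ⟨a, rfl⟩ := List.length_eq_one_iff.1 h
  rfl

theorem NzPath.val_mul_ar_eq_zero {γ : G.NzPath} {b : A}
    (h : G.Q.arrow k γ.first * G.Q.arrow k b ∈ G.Q.ideal k) : γ.val * G.ar b = 0 := by
  rw [← arrowPath_val]
  exact G.word_mul_eq_zero γ.ne_nil (γ := G.arrowPath b) h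

variable (M) in
/-- The relation `m ∈ x {m'}` for a pair `x` of homotopy letters. -/
def Letter.Rel : G.Letter → Total M → Total M → Prop
  | .dir γ, m, m' => m ∈ vertexPart M γ.tl ∧ IsArrowD M γ.last m' (γ.val • m)
  | .inv γ, m, m' => IsArrowD M γ.last m (γ.val • m') ∧ m' ∈ vertexPart M γ.tl

/-- The summand which a letter `x`, going from the place of `m` to the place of `m'`, contributes to
the differential of `m`. -/
def Letter.plus {T : Type*} [AddCommGroup T] [Module G.Alg T] : G.Letter → T → T
  | .dir _, _ => 0
  | .inv γ, m' => γ.val • m'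

namespace Letter

theorem rel_flip {x : G.Letter} {m m' : Total M} : x.flip.Rel M m' m ↔ x.Rel M m m' := by
  cases x <;> exact and_comm

theorem Rel.mem_hd {x : G.Letter} {m m' : Total M} (h : x.Rel M m m') : m ∈ vertexPart M x.hd := by
  cases x
  exacts [h.1, h.1.1]

theorem Rel.mem_tl {x : G.Letter} {m m' : Total M} (h : x.Rel M m m') :
    m' ∈ vertexPart M x.tl := by
  cases x
  exacts [h.2.1, h.2]

theorem Rel.mem_act {x : G.Letter} {m m' : Total M} (h : x.Rel M m m') {U : Set (Total M)}
    (hU : m' ∈ U) : m ∈ x.act M U := by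
  cases x
  · exact ⟨h.1, m', hU, h.2⟩
  · exact ⟨h.1.1, _, ⟨m', hU, rfl⟩, h.1⟩

theorem act_subset (x : G.Letter) (U : Set (Total M)) : x.act M U ⊆ vertexPart M x.hd := by
  intro m hm
  cases x <;> exact hm.1

theorem exists_rel_of_mem_act {x : G.Letter} {U : Set (Total M)} (hU : U ⊆ vertexPart M x.tl)
    {m : Total M} (hm : m ∈ x.act M U) : ∃ m' ∈ U, x.Rel M m m' := by
  cases x
  · obtain ⟨hv, m', hm', hd⟩ := hm
    exact ⟨m', hm', hv, hd⟩
  · obtain ⟨-, _, ⟨m', hm', rfl⟩, hd⟩ := hm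
    exact ⟨m', hm', hd, hU hm'⟩

theorem exists_rel_of_isInvArrow (hM : IsMinimalTorsionless M) {x : G.Letter} (hx : x.IsInvArrow)
    {m : Total M} (hm : m ∈ vertexPart M x.hd) : ∃ m', x.Rel M m m' := by
  rcases x with γ | γ
  · exact hx.elim
  obtain ⟨c, hc⟩ := hM.exists_totalD_eq_sum hm
  refine ⟨G.e γ.tl • c γ.last, ⟨hm, c, hc, ?_⟩, ?_⟩
  · rw [NzPath.IsArrow.eq_arrowPath hx, arrowPath_val, smul_smul]
    exact congrArg (· • _) (G.ar_mul_e _)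
  · change G.e _ • G.e _ • _ = _
    rw [smul_smul, triv_idem]

open Classical in
theorem rel_dir_sum_eq (hT : IsTorsionless G.Alg (Total M)) {γ : G.NzPath} {m m' : Total M}
    (h : (dir γ).Rel M m m') {c : A → Total M}
    (hc : totalD M m = ∑ b ∈ Finset.univ.filter (fun b => G.Q.hd b = γ.tl), G.ar b • c b) :
    ∑ b ∈ Finset.univ.filter
      (fun b => G.Q.hd b = γ.tl ∧ G.sign (Sum.inl b) = -G.sign (Sum.inr γ.first)),
      G.ar b • c b = 0 := by
  have hd : γ.val • totalD M m = 0 := by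
    rw [← map_smul]
    exact h.2.totalD_eq_zero hT
  refine Finset.sum_eq_zero fun b hb => ?_
  obtain ⟨hbv, hbs⟩ := (Finset.mem_filter.1 hb).2
  have hcomp : G.Composable γ.first b :=
    ⟨hbv.symm, fun hmem => neg_units_iff.1 hbs ((sign_mixed hbv.symm).2 hmem).symm⟩
  have hzero (b' : A) (hv : G.Q.hd b' = γ.tl) (hne : b' ≠ b) : γ.val • G.ar b' • c b' = 0 := by
    have hmem : G.Q.arrow k γ.first * G.Q.arrow k b' ∈ G.Q.ideal k := by
      refine (sign_mixed hv.symm).1 (by_contra fun hs => hne (sign_hd_eq (hv.trans hbv.symm) ?_))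
      rw [hbs]
      exact neg_units_iff.2 (Ne.symm hs)
    rw [smul_smul, NzPath.val_mul_ar_eq_zero hmem, zero_smul]
  refine γ.val_smul_cancel hT hcomp ?_
  rwa [hc, Finset.smul_sum, Finset.sum_eq_single b
    (fun b' hb' => hzero b' (Finset.mem_filter.1 hb').2) (fun h => absurd (by simpa using hbv) h)]
    at hd

open Classical in
theorem rel_inv_sum_eq (hT : IsTorsionless G.Alg (Total M)) {γ : G.NzPath} {m m' : Total M}
    (h : (inv γ).Rel M m m') {c : A → Total M}
    (hc : totalD M m = ∑ b ∈ Finset.univ.filter (fun b => G.Q.hd b = γ.hd), G.ar b • c b) :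
    ∑ b ∈ Finset.univ.filter
      (fun b => G.Q.hd b = γ.hd ∧ G.sign (Sum.inl b) = G.sign (Sum.inl γ.last)),
      G.ar b • c b = γ.val • m' := by
  rw [h.1.eq_ar_smul hT hc]
  refine Finset.sum_eq_single γ.last (fun b hb hne => ?_) fun h =>
    absurd (Finset.mem_filter.2 ⟨Finset.mem_univ _, rfl, rfl⟩) h
  obtain ⟨hbv, hbs⟩ := (Finset.mem_filter.1 hb).2
  exact absurd (sign_hd_eq hbv hbs) hne

end Letter

open Classical in
theorem IsMaximalAt.sum_eq (hT : IsTorsionless G.Alg (Total M)) {v : V} {ε : ℤˣ}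
    {o : Option G.Letter} (ho : IsMaximalAt v ε o) {m m' : Total M}
    (hrel : ∀ x ∈ o, x.Rel M m m') {c : A → Total M}
    (hc : totalD M m = ∑ b ∈ Finset.univ.filter (fun b => G.Q.hd b = v), G.ar b • c b) :
    ∑ b ∈ Finset.univ.filter (fun b => G.Q.hd b = v ∧ G.sign (Sum.inl b) = -ε), G.ar b • c b =
      o.elim 0 fun x => x.plus m' := by
  rcases o with _ | γ | γ
  · refine Finset.sum_eq_zero fun b hb => ?_
    obtain ⟨hbv, hbs⟩ := (Finset.mem_filter.1 hb).2
    exact absurd (neg_eq_iff_eq_neg.2 hbs)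
      (ho.eq_none rfl (.inv (G.arrowPath b)) (List.length_singleton) hbv)
  · obtain rfl := ho.hd_eq _ rfl
    obtain rfl := ho.sgn_eq _ rfl
    exact Letter.rel_dir_sum_eq hT (hrel _ rfl) hc
  · obtain rfl := ho.hd_eq _ rfl
    obtain rfl := ho.sgn_eq _ rfl
    simp only [Letter.sgn, neg_neg]
    exact Letter.rel_inv_sum_eq hT (hrel _ rfl) hc

theorem totalD_eq_of_isMaximalAt (hM : IsMinimalTorsionless M) {v : V} {ε : ℤˣ}
    {o o' : Option G.Letter} (ho : IsMaximalAt v ε o) (ho' : IsMaximalAt v (-ε) o')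
    {m m₁ m₂ : Total M} (hm : m ∈ vertexPart M v) (hrel : ∀ x ∈ o, x.Rel M m m₁)
    (hrel' : ∀ x ∈ o', x.Rel M m m₂) :
    totalD M m = (o'.elim 0 fun x => x.plus m₂) + o.elim 0 fun x => x.plus m₁ := by
  classical
  obtain ⟨c, hc⟩ := hM.exists_totalD_eq_sum hm
  rw [← ho.sum_eq hM.total hrel hc, ← ho'.sum_eq hM.total hrel' hc, hc,
    ← Finset.sum_filter_add_sum_filter_not _ (fun b => G.sign (Sum.inl b) = -ε),
    Finset.filter_filter, Finset.filter_filter, add_comm]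
  simp only [neg_neg, ← Letter.neg_units_iff]

end Differential

/-! ### Sequences of elements along a word -/

section Sequences

namespace FinWord

variable {v : V} {δ : ℤˣ} (C : G.FinWord v δ)

theorem ext_letter_of_lt {n : ℕ} (h : n < C.letters.length) :
    C.ext.letter (n + 1) = some C.letters[n] := by
  change C.extLetter (n + 1) = _
  rw [C.extLetter_of_pos (by lia), show ((n : ℤ) + 1 - 1).toNat = n by lia, C.right_of_lt h]

theorem isInvArrow_of_ext_letter {n : ℕ} (h : C.letters.length ≤ n) {x : G.Letter}
    (hx : C.ext.letter (n + 1) = some x) : x.IsInvArrow := by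
  change C.extLetter (n + 1) = _ at hx
  rw [C.extLetter_of_pos (by lia), show ((n : ℤ) + 1 - 1).toNat = n by lia,
    C.right_of_ge h] at hx
  rcases hn : n - C.letters.length with _ | j <;> rw [hn] at hx
  · exact (C.startRight_eq_some.1 hx).1
  · obtain ⟨y, -, hy⟩ := iterOpt_succ_eq_some.1 hx
    exact (G.nextInv_eq_some.1 hy).1

theorem isDirArrow_of_ext_letter {i : ℤ} (hi : i ≤ 0) {x : G.Letter}
    (hx : C.ext.letter i = some x) : x.IsDirArrow :=
  triv_letter_le hi ((C.letter_le hi).trans hx)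

theorem ext_vert_length : C.ext.vert C.letters.length = C.endVert := by
  rcases hn : C.letters.length with _ | n
  · simp [endVert, List.length_eq_zero_iff.1 hn, GWord.vert, ext]
  · have hlt : n < C.letters.length := by lia
    have hlast : C.letters.getLast? = some C.letters[n] := by
      rw [List.getLast?_eq_getElem?, hn, Nat.add_sub_cancel, List.getElem?_eq_getElem hlt]
    rw [Nat.cast_succ, (C.ext.vert_of_letter (C.ext_letter_of_lt hlt)).1, endVert, hlast]
    rfl

variable (M) in
/-- The subspace `l_{n+1}⁻¹ r_{n+1} ⋯ l_t⁻¹ r_t e_u M` given by the pairs of `C` after the place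
`n`, and `e_{v(n)} M` at the places `n > t` of the right hand extension. -/
def tailAct (n : ℕ) : Set (Total M) :=
  (C.letters.drop n).foldr (fun x U => x.act M U)
    (vertexPart M (C.ext.vert (max n C.letters.length : ℕ)))

theorem tailAct_zero : C.tailAct M 0 = C.act M := by
  rw [tailAct, List.drop_zero, Nat.zero_max, ext_vert_length, act]

theorem tailAct_of_lt {n : ℕ} (h : n < C.letters.length) :
    C.tailAct M n = C.letters[n].act M (C.tailAct M (n + 1)) := by
  rw [tailAct, tailAct, List.drop_eq_getElem_cons h, List.foldr_cons, max_eq_right h.le,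
    max_eq_right h]

theorem tailAct_of_ge {n : ℕ} (h : C.letters.length ≤ n) :
    C.tailAct M n = vertexPart M (C.ext.vert n) := by
  rw [tailAct, List.drop_eq_nil_of_le h, List.foldr_nil, max_eq_left h]

theorem tailAct_subset (n : ℕ) : C.tailAct M n ⊆ vertexPart M (C.ext.vert n) := by
  rcases lt_or_ge n C.letters.length with h | h
  · have hv := (C.ext.vert_of_letter (C.ext_letter_of_lt h)).2.1
    rw [add_sub_cancel_right] at hv
    rw [C.tailAct_of_lt h, hv]
    exact Letter.act_subset _ _
  · rw [C.tailAct_of_ge h]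

theorem act_subset : C.act M ⊆ vertexPart M v := C.tailAct_zero ▸ C.tailAct_subset 0

theorem exists_rel_of_mem_tailAct (hM : IsMinimalTorsionless M) {n : ℕ} {m : Total M}
    (hm : m ∈ C.tailAct M n) :
    ∃ m' ∈ C.tailAct M (n + 1), ∀ x ∈ C.ext.letter (n + 1), x.Rel M m m' := by
  have hsub := C.tailAct_subset (M := M) (n + 1)
  rcases lt_or_ge n C.letters.length with h | h
  · have hx := C.ext_letter_of_lt h
    rw [Nat.cast_succ, (C.ext.vert_of_letter hx).1] at hsub
    rw [C.tailAct_of_lt h] at hm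
    obtain ⟨m', hm', hrel⟩ := Letter.exists_rel_of_mem_act hsub hm
    exact ⟨m', hm', by simpa [hx] using hrel⟩
  rw [C.tailAct_of_ge (by lia)]
  rcases hx : C.ext.letter (n + 1) with _ | x
  · exact ⟨0, smul_zero _, by simp⟩
  · obtain ⟨htl, hhd, -⟩ := C.ext.vert_of_letter hx
    rw [add_sub_cancel_right] at hhd
    rw [C.tailAct_of_ge h, hhd] at hm
    obtain ⟨m', hrel⟩ := Letter.exists_rel_of_isInvArrow hM (C.isInvArrow_of_ext_letter h hx) hm
    refine ⟨m', ?_, by simpa using hrel⟩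
    rw [Nat.cast_succ, htl]
    exact hrel.mem_tl

theorem exists_rel_of_mem_vertexPart (hM : IsMinimalTorsionless M) {n : ℕ} {m : Total M}
    (hm : m ∈ vertexPart M (C.ext.vert (-n))) :
    ∃ m' ∈ vertexPart M (C.ext.vert (-(n + 1 : ℕ))), ∀ x ∈ C.ext.letter (-n), x.Rel M m' m := by
  rcases hx : C.ext.letter (-n) with _ | x
  · exact ⟨0, smul_zero _, by simp⟩
  obtain ⟨htl, hhd, -⟩ := C.ext.vert_of_letter hx
  rw [htl, ← Letter.flip_hd] at hm
  obtain ⟨m', hrel⟩ := Letter.exists_rel_of_isInvArrow hM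
    ((Letter.isInvArrow_flip x).2 (C.isDirArrow_of_ext_letter (by lia) hx)) hm
  rw [← Letter.rel_flip, Letter.flip_flip] at hrel
  refine ⟨m', ?_, by simpa using hrel⟩
  rw [Nat.cast_succ, neg_add, ← sub_eq_add_neg, hhd]
  exact hrel.mem_hd

theorem exists_rel_seq (hM : IsMinimalTorsionless M) {m : Total M} (hm : m ∈ C.act M) :
    ∃ s : ℤ → Total M, s 0 = m ∧ ∀ i, ∀ x ∈ C.ext.letter i, x.Rel M (s (i - 1)) (s i) := by
  obtain ⟨s₁, hs₁, hrel₁⟩ := exists_seq_of_forall_exists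
    (fun n m => C.exists_rel_of_mem_tailAct hM (n := n) (m := m)) (C.tailAct_zero.symm ▸ hm)
  obtain ⟨s₂, hs₂, hrel₂⟩ := exists_seq_of_forall_exists
    (fun n m => C.exists_rel_of_mem_vertexPart hM (n := n) (m := m)) (C.act_subset hm)
  let s : ℤ → Total M := fun i => if 0 ≤ i then s₁ i.toNat else s₂ (-i).toNat
  have hs_nat (n : ℕ) : s n = s₁ n := if_pos n.cast_nonneg
  have hs_neg (n : ℕ) : s (-n) = s₂ n := by
    rcases n with _ | n
    · rw [Nat.cast_zero, neg_zero, ← Nat.cast_zero, hs_nat, hs₁, hs₂]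
    · exact if_neg (by lia)
  refine ⟨s, (hs_nat 0).trans hs₁, fun i x hx => ?_⟩
  rcases lt_or_ge 0 i with hi | hi
  · obtain ⟨n, rfl⟩ : ∃ n : ℕ, i = n + 1 := ⟨(i - 1).toNat, by lia⟩
    rw [add_sub_cancel_right, ← Nat.cast_succ, hs_nat, hs_nat]
    exact hrel₁ n x hx
  · obtain ⟨n, rfl⟩ : ∃ n : ℕ, i = -n := ⟨(-i).toNat, by lia⟩
    rw [show -(n : ℤ) - 1 = -(n + 1 : ℕ) by lia, hs_neg, hs_neg]
    exact hrel₂ n x hx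

theorem mem_vertexPart_of_rel {s : ℤ → Total M} (h0 : s 0 ∈ vertexPart M v)
    (hs : ∀ i, ∀ x ∈ C.ext.letter i, x.Rel M (s (i - 1)) (s i)) {i : ℤ} (hi : i ∈ C.ext.index) :
    s i ∈ vertexPart M (C.ext.vert i) := by
  rcases lt_trichotomy 0 i with h | rfl | h
  · obtain ⟨x, hx⟩ := Option.isSome_iff_exists.1 (hi.1 h)
    rw [(C.ext.vert_of_letter hx).1]
    exact (hs i x hx).mem_tl
  · exact h0
  · obtain ⟨x, hx⟩ := Option.isSome_iff_exists.1 (hi.2 h)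
    have hrel := hs _ x hx
    have hv := (C.ext.vert_of_letter hx).2.1
    rw [add_sub_cancel_right] at hv hrel
    exact hv ▸ hrel.mem_hd

theorem totalD_eq_of_rel (hM : IsMinimalTorsionless M) {s : ℤ → Total M}
    (h0 : s 0 ∈ vertexPart M v)
    (hs : ∀ i, ∀ x ∈ C.ext.letter i, x.Rel M (s (i - 1)) (s i)) {i : ℤ} (hi : i ∈ C.ext.index) :
    totalD M (s i) = (((C.ext.letter i).map Letter.flip).elim 0 fun x => x.plus (s (i - 1))) +
      (C.ext.letter (i + 1)).elim 0 fun x => x.plus (s (i + 1)) := by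
  obtain ⟨ε, hright, hleft⟩ := C.exists_isMaximalAt hi
  refine totalD_eq_of_isMaximalAt hM hright hleft (C.mem_vertexPart_of_rel h0 hs hi)
    (fun x hx => ?_) fun x hx => ?_
  · simpa only [add_sub_cancel_right] using hs (i + 1) x hx
  · have hrel := hs i x.flip (map_flip_eq_some.1 hx)
    rwa [← Letter.rel_flip, Letter.flip_flip] at hrel

end FinWord

end Sequences

/-! ### Chain maps out of the complex of a word -/

section ChainMaps

theorem Letter.Adj.flip {x y : G.Letter} (h : x.Adj y) : y.flip.Adj x.flip := by
  cases x <;> cases y <;> first | exact ⟨h.1.symm, h.2.symm⟩ | exact ⟨h.1.symm, h.2⟩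

open Classical in
theorem NzPath.val_smul_eq_sum {T : Type*} [AddCommGroup T] [Module G.Alg T] (γ : G.NzPath)
    (x : T) :
    γ.val • x = ∑ b ∈ Finset.univ.filter (fun b => G.Q.hd b = γ.hd),
      G.ar b • (Pi.single γ.last (γ.rest • x) : A → T) b := by
  have hlast : γ.last ∈ Finset.univ.filter (fun b => G.Q.hd b = γ.hd) :=
    Finset.mem_filter.2 ⟨Finset.mem_univ _, rfl⟩
  rw [Finset.sum_eq_single_of_mem _ hlast fun b _ hb => by
      rw [Pi.single_eq_of_ne hb, smul_zero],
    Pi.single_eq_same, smul_smul, ← NzPath.val_eq]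

theorem isArrowD_of_adj {γ : G.NzPath} {o : Option G.Letter} (ho : ∀ y ∈ o, (Letter.dir γ).Adj y)
    {m a b : Total M} (hm : m ∈ vertexPart M γ.hd)
    (h : totalD M m = γ.val • a + o.elim 0 fun y => y.plus b) :
    IsArrowD M γ.last m (γ.val • a) := by
  classical
  have hγ : γ.val • a = G.ar γ.last • (Pi.single γ.last (γ.rest • a) : A → Total M) γ.last := by
    rw [Pi.single_eq_same, smul_smul, ← NzPath.val_eq]
  rcases o with _ | ν | ν
  · exact ⟨hm, _, (h.trans (add_zero _)).trans (γ.val_smul_eq_sum a), hγ⟩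
  · exact ⟨hm, _, (h.trans (add_zero _)).trans (γ.val_smul_eq_sum a), hγ⟩
  · obtain ⟨hhd, hlast⟩ := ho _ rfl
    refine ⟨hm, Pi.single γ.last (γ.rest • a) + Pi.single ν.last (ν.rest • b), ?_, ?_⟩
    · refine h.trans ?_
      simp only [Option.elim_some, Letter.plus, Pi.add_apply, smul_add, Finset.sum_add_distrib]
      rw [γ.val_smul_eq_sum a, ν.val_smul_eq_sum b, ← hhd]
      rfl
    · rw [hγ, Pi.add_apply, Pi.single_eq_of_ne hlast, add_zero]

namespace GWord

variable (C : G.GWord)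

theorem map_bPlus {T : Type*} [AddCommGroup T] [Module G.Alg T] (F : (ℤ →₀ G.Alg) →ₗ[G.Alg] T)
    (i : ℤ) : F (C.bPlus i) = (C.letter (i + 1)).elim 0 fun x => x.plus (F (C.b (i + 1))) := by
  rcases h : C.letter (i + 1) with _ | γ | γ
  · rw [C.bPlus_of_not (by simp [h]), map_zero]; rfl
  · rw [C.bPlus_of_not (by simp [h]), map_zero]; rfl
  · rw [C.bPlus_of h, map_smul]; rfl

theorem map_bMinus {T : Type*} [AddCommGroup T] [Module G.Alg T] (F : (ℤ →₀ G.Alg) →ₗ[G.Alg] T)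
    (i : ℤ) :
    F (C.bMinus i) = ((C.letter i).map Letter.flip).elim 0 fun x => x.plus (F (C.b (i - 1))) := by
  rcases h : C.letter i with _ | γ | γ
  · rw [C.bMinus_of_not (by simp [h]), map_zero]; rfl
  · rw [C.bMinus_of h, map_smul]; rfl
  · rw [C.bMinus_of_not (by simp [h]), map_zero]; rfl

theorem e_smul_b (i : ℤ) : G.e (C.vert i) • C.b i = C.b i := by
  rw [b, Finsupp.smul_single, smul_eq_mul, triv_idem]

theorem map_b_mem_vertexPart (F : (ℤ →₀ G.Alg) →ₗ[G.Alg] Total M) (i : ℤ) :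
    F (C.b i) ∈ vertexPart M (C.vert i) := by
  change G.e (C.vert i) • F (C.b i) = F (C.b i)
  rw [← map_smul, e_smul_b]

/-- `F` commutes with the differentials on `P(C)`, regarded as a submodule of the free module on the
integers. The degrees are forgotten, and with them the signs which the shift introduces. -/
def IsChainMap (F : (ℤ →₀ G.Alg) →ₗ[G.Alg] Total M) : Prop :=
  ∀ i ∈ C.index, totalD M (F (C.b i)) = F (C.diff (C.b i))

namespace IsChainMap

variable {C} {F : (ℤ →₀ G.Alg) →ₗ[G.Alg] Total M}

theorem totalD_apply (hF : C.IsChainMap F) {n : ℤ} {x : ℤ →₀ G.Alg} (hx : x ∈ C.piece n) :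
    totalD M (F x) = F (C.diff x) := by
  have hle : C.piece n ≤ LinearMap.eqLocus (totalD M ∘ₗ F) (F ∘ₗ C.diff) := by
    refine Submodule.span_le.2 ?_
    rintro _ ⟨i, hi, -, rfl⟩
    exact hF i hi
  exact hle hx

theorem rel (hF : C.IsChainMap F) {i : ℤ} {x : G.Letter} (hx : C.letter i = some x) :
    x.Rel M (F (C.b (i - 1))) (F (C.b i)) := by
  obtain ⟨htl, hhd, hi, hi'⟩ := C.vert_of_letter hx
  have hm := htl ▸ C.map_b_mem_vertexPart F i
  have hm' := hhd ▸ C.map_b_mem_vertexPart F (i - 1)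
  rcases x with γ | γ
  · have hd := hF i hi
    rw [diff_b, map_add, map_bMinus, map_bPlus, hx] at hd
    exact ⟨hm', isArrowD_of_adj (fun y hy => C.adj i _ y hx hy) hm hd⟩
  · have hd := hF (i - 1) hi'
    rw [diff_b, map_add, map_bMinus, map_bPlus, sub_add_cancel, hx, add_comm] at hd
    refine ⟨isArrowD_of_adj (fun y hy => ?_) hm' hd, hm⟩
    have hadj := C.adj (i - 1) _ _ (map_flip_eq_some.1 hy) (by rwa [sub_add_cancel])
    exact Letter.flip_flip y ▸ hadj.flip

end IsChainMap

end GWord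

theorem GWord.IsChainMap.mem_tailAct {v : V} {δ : ℤˣ} {C : G.FinWord v δ}
    {F : (ℤ →₀ G.Alg) →ₗ[G.Alg] Total M} (hF : C.ext.IsChainMap F) (n : ℕ) :
    F (C.ext.b n) ∈ C.tailAct M n := by
  rcases lt_or_ge n C.letters.length with h | h
  · have hrel := hF.rel (C.ext_letter_of_lt h)
    rw [add_sub_cancel_right] at hrel
    rw [C.tailAct_of_lt h]
    exact hrel.mem_act (by exact_mod_cast hF.mem_tailAct (n + 1))
  · rw [C.tailAct_of_ge h]
    exact C.ext.map_b_mem_vertexPart F n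
termination_by C.letters.length - n

theorem FinWord.mem_act_iff (hM : IsMinimalTorsionless M) {v : V} {δ : ℤˣ} {C : G.FinWord v δ}
    {m : Total M} :
    m ∈ C.act M ↔
      ∃ F : (ℤ →₀ G.Alg) →ₗ[G.Alg] Total M, C.ext.IsChainMap F ∧ F (C.ext.b 0) = m := by
  constructor
  · intro hm
    obtain ⟨s, rfl, hs⟩ := C.exists_rel_seq hM hm
    have h0 := C.act_subset hm
    have hb {i : ℤ} (hi : i ∈ C.ext.index) :
        Finsupp.linearCombination G.Alg s (C.ext.b i) = s i := by
      rw [GWord.b, Finsupp.linearCombination_single]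
      exact C.mem_vertexPart_of_rel h0 hs hi
    refine ⟨Finsupp.linearCombination G.Alg s, fun i hi => ?_, hb C.ext.zero_mem_index⟩
    rw [hb hi, C.totalD_eq_of_rel hM h0 hs hi, GWord.diff_b, map_add, GWord.map_bMinus,
      GWord.map_bPlus]
    congr 1
    · rcases hx : C.ext.letter i with _ | x
      · rfl
      · simp only [hb (C.ext.vert_of_letter hx).2.2.2]
    · rcases hx : C.ext.letter (i + 1) with _ | x
      · rfl
      · simp only [hb (C.ext.vert_of_letter hx).2.2.1]
  · rintro ⟨F, hF, rfl⟩
    simpa only [tailAct_zero, Nat.cast_zero] using hF.mem_tailAct 0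

end ChainMaps

/-! ### Morphisms out of the shifted complex -/

section Shift

/-- The sign which turns a map commuting with the differentials on `P(C)` into a morphism
`P(C)[r] ⟶ M` in degree `n`, the differential of `P(C)[r]` being `(-1) ^ r` times that of `P(C)`. -/
def shiftSign (r n : ℤ) : ℤˣ := (r * (n - r)).negOnePow

theorem shiftSign_self (r : ℤ) : shiftSign r r = 1 := by simp [shiftSign]

theorem shiftSign_succ (r n : ℤ) : shiftSign r (n + 1) = shiftSign r n * r.negOnePow := by
  rw [shiftSign, shiftSign, ← Int.negOnePow_add]
  congr 1
  ring

namespace GWord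

variable {C : G.GWord} {r : ℤ}

variable (C r) in
/-- An element of `P(C)` of degree `n - r`, as an element of degree `n` of the shifted complex. -/
def shiftElem {n : ℤ} (x : C.piece (n + -r)) : ((degShift (G := G) r).obj C.complex).X n :=
  x

theorem shift_d_shiftElem {n : ℤ} (x : C.piece (n + -r)) :
    ((degShift (G := G) r).obj C.complex).d n (n + 1) (C.shiftElem r x) =
      r.negOnePow • C.shiftElem r ⟨C.diff x.1, C.diff_mem (by lia) x.1 x.2⟩ := by
  have h : n + -r + 1 = n + 1 + -r := by lia
  rw [CochainComplex.shiftFunctor_obj_d', Int.negOnePow_neg]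
  simp only [complex, dif_pos h]
  rfl

theorem b_mem_piece_mu {i : ℤ} (hi : i ∈ C.index) : C.b i ∈ C.piece (C.mu i + r + -r) :=
  C.b_mem hi (by lia)

theorem bShift_eq : C.bShift r =
    C.shiftElem r ⟨C.b 0, C.b_mem C.zero_mem_index (by rw [mu_zero]; lia)⟩ := by
  have hcast {n m : ℤ} (h : n = m) (x : C.piece n) (y : C.piece m) (hxy : x.1 = y.1) :
      (HomologicalComplex.XIsoOfEq C.complex h).hom (x : C.complex.X n) = (y : C.complex.X m) := by
    subst h
    rw [HomologicalComplex.XIsoOfEq_rfl]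
    exact Subtype.ext hxy
  exact hcast (by lia : (0 : ℤ) = r + -r) _ _ rfl

theorem IsChainMap.exists_hom {F : (ℤ →₀ G.Alg) →ₗ[G.Alg] Total M} (hF : C.IsChainMap F) (r : ℤ) :
    ∃ f : (degShift (G := G) r).obj C.complex ⟶ M,
      f.f r (C.bShift r) = DirectSum.component G.Alg ℤ (fun i => M.X i) r (F (C.b 0)) := by
  let L (n : ℤ) : C.piece (n + -r) →ₗ[G.Alg] M.X n :=
    shiftSign r n • DirectSum.component G.Alg ℤ (fun i => M.X i) n ∘ₗ F ∘ₗ (C.piece _).subtype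
  have hL (n : ℤ) (x : C.piece (n + -r)) : M.d n (n + 1) (L n x) =
      (r.negOnePow : ℤ) • L (n + 1) ⟨C.diff x.1, C.diff_mem (by lia) x.1 x.2⟩ := by
    rw [← Units.smul_def]
    simp only [L, LinearMap.smul_apply, LinearMap.comp_apply, Submodule.subtype_apply,
      ← hF.totalD_apply x.2, component_totalD, shiftSign_succ, smul_smul]
    rw [mul_comm, mul_assoc, Int.units_mul_self, mul_one]
    exact (M.d n (n + 1)).hom.map_smul_of_tower _ _
  refine ⟨{ f n := ModuleCat.ofHom (X := C.piece (n + -r)) (L n), comm' := ?_ }, ?_⟩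
  · rintro n _ rfl
    exact ModuleCat.hom_ext (LinearMap.ext fun x =>
      ((hL n x).trans (map_zsmul (L (n + 1)) _ _).symm).trans
        (congrArg (L (n + 1)) (shift_d_shiftElem x).symm))
  · rw [bShift_eq]
    change shiftSign r r • DirectSum.component G.Alg ℤ (fun i => M.X i) r (F (C.b 0)) = _
    rw [shiftSign_self, one_smul]

/-- A morphism `P(C)[r] ⟶ M` in degree `n`, with the sign which makes it commute with the
differential of `P(C)`. -/
def unshift (f : (degShift (G := G) r).obj C.complex ⟶ M) (n : ℤ) :
    C.piece (n + -r) →ₗ[G.Alg] Total M :=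
  shiftSign r n • DirectSum.lof G.Alg ℤ (fun i => M.X i) n ∘ₗ
    (show C.piece (n + -r) →ₗ[G.Alg] M.X n from (f.f n).hom)

variable (f : (degShift (G := G) r).obj C.complex ⟶ M)

theorem unshift_apply {n : ℤ} (x : C.piece (n + -r)) :
    unshift f n x =
      shiftSign r n • DirectSum.lof G.Alg ℤ (fun i => M.X i) n (f.f n (C.shiftElem r x)) :=
  rfl

theorem totalD_unshift {n : ℤ} (x : C.piece (n + -r)) :
    totalD M (unshift f n x) =
      unshift f (n + 1) ⟨C.diff x.1, C.diff_mem (by lia) x.1 x.2⟩ := by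
  have hcomm : M.d n (n + 1) (f.f n (C.shiftElem r x)) =
      f.f (n + 1) (((degShift (G := G) r).obj C.complex).d n (n + 1) (C.shiftElem r x)) :=
    congrArg (fun g => g.hom (C.shiftElem r x)) (f.comm n (n + 1))
  rw [unshift_apply, unshift_apply, LinearMap.map_smul_of_tower, totalD_lof, hcomm,
    shift_d_shiftElem, shiftSign_succ, mul_smul]
  congr 1
  exact (DirectSum.lof G.Alg ℤ (fun i => M.X i) (n + 1) ∘ₗ
    (f.f (n + 1)).hom).map_smul_of_tower _ _

theorem exists_linearMap_eq_unshift :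
    ∃ F : (ℤ →₀ G.Alg) →ₗ[G.Alg] Total M, ∀ n (x : C.piece (n + -r)), F x.1 = unshift f n x := by
  classical
  let F := Finsupp.linearCombination G.Alg fun i =>
    if hi : i ∈ C.index then unshift f _ ⟨C.b i, b_mem_piece_mu hi⟩ else 0
  refine ⟨F, fun n x => ?_⟩
  obtain ⟨x, hx⟩ := x
  induction hx using Submodule.span_induction with
  | mem x hx =>
    obtain ⟨i, hi, hn, rfl⟩ := hx
    obtain rfl : n = C.mu i + r := by lia
    simp only [F]
    conv_lhs => rw [b, Finsupp.linearCombination_single, dif_pos hi, ← map_smul]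
    exact congrArg _ (Subtype.ext (C.e_smul_b i))
  | zero => exact (map_zero F).trans (map_zero (unshift f n)).symm
  | add x y hx hy hFx hFy =>
    exact ((map_add F x y).trans (congrArg₂ _ hFx hFy)).trans
      (map_add (unshift f n) ⟨x, hx⟩ ⟨y, hy⟩).symm
  | smul a x hx hFx =>
    exact ((map_smul F a x).trans (congrArg _ hFx)).trans
      (map_smul (unshift f n) a ⟨x, hx⟩).symm

theorem exists_isChainMap :
    ∃ F : (ℤ →₀ G.Alg) →ₗ[G.Alg] Total M, C.IsChainMap F ∧
      F (C.b 0) = DirectSum.lof G.Alg ℤ (fun i => M.X i) r (f.f r (C.bShift r)) := by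
  obtain ⟨F, hF⟩ := exists_linearMap_eq_unshift f
  refine ⟨F, fun i hi => ?_, ?_⟩
  · let x : C.piece (C.mu i + r + -r) := ⟨C.b i, b_mem_piece_mu hi⟩
    exact ((congrArg _ (hF _ x)).trans (totalD_unshift f x)).trans (hF _ _).symm
  · refine (hF r ⟨C.b 0, C.b_mem C.zero_mem_index (by rw [mu_zero]; lia)⟩).trans ?_
    rw [unshift_apply, shiftSign_self, one_smul, ← bShift_eq]

end GWord

end Shift

/-! ### The subgroups given by `a⟨C⟩` -/

section Subgroups

theorem FinWord.compactMap_bShift {v : V} {δ : ℤˣ} (C : G.FinWord v δ) (r : ℤ) :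
    ((degShift (G := G) r).map C.compactMap).f r ((triv G v δ).bShift r) = C.ext.bShift r := by
  rw [GWord.bShift_eq, GWord.bShift_eq]
  refine Subtype.ext ?_
  change C.aLin ((triv G v δ).b 0) = C.ext.b 0
  rw [aLin_b, aVal_flat]
  exact C.flat_of_le le_rfl (GWord.zero_mem_index _)

theorem FinWord.mem_act_iff_exists_hom (hM : IsMinimalTorsionless M) {v : V} {δ : ℤˣ}
    {C : G.FinWord v δ} {r : ℤ} {m : M.X r} :
    DirectSum.lof G.Alg ℤ (fun i => M.X i) r m ∈ C.act M ↔
      ∃ f : (degShift (G := G) r).obj C.ext.complex ⟶ M, m = f.f r (C.ext.bShift r) := by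
  rw [mem_act_iff hM]
  constructor
  · rintro ⟨F, hF, hm⟩
    obtain ⟨f, hf⟩ := hF.exists_hom r
    exact ⟨f, by rw [hf, hm, DirectSum.component.lof_self]⟩
  · rintro ⟨f, rfl⟩
    exact GWord.exists_isChainMap f

theorem e_smul_eq_of_lof_mem_act {v : V} {δ : ℤˣ} {C : G.FinWord v δ} {r : ℤ} {m : M.X r}
    (hm : DirectSum.lof G.Alg ℤ (fun i => M.X i) r m ∈ C.act M) : G.e v • m = m := by
  have hv := congrArg (DirectSum.component G.Alg ℤ (fun i => M.X i) r)
    (show G.e v • _ = _ from C.act_subset hm)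
  rwa [map_smul, DirectSum.component.lof_self] at hv

theorem ppSubgroup_map {T T' : Type*} [Category T] [Preadditive T] [Category T'] [Preadditive T']
    (F : T ⥤ T') [F.Additive] [F.Full] {X Y : T} (a : X ⟶ Y) (M : T) :
    ppSubgroup (F.map a) (F.obj M) = (ppSubgroup a M).map F.mapAddHom := by
  ext g
  constructor
  · rintro ⟨φ, rfl⟩
    obtain ⟨f, rfl⟩ := F.map_surjective φ
    exact ⟨a ≫ f, ⟨f, rfl⟩, F.map_comp a f⟩
  · rintro ⟨_, ⟨f, rfl⟩, rfl⟩
    exact ⟨F.map f, (F.map_comp a f).symm⟩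

end Subgroups

end GentleData

end

theorem lemma5_general {k V A : Type u} [Field k] [Fintype V] [Fintype A]
    (G : GentleData k V A) (M : CochainComplex (ModuleCat.{u} G.Alg) ℤ)
    (hM : GentleData.IsMinimalTorsionless M)
    (v : V) (δ : ℤˣ) (C : G.FinWord v δ) (r : ℤ) :
    {m : M.X r | G.e v • m = m ∧ DirectSum.lof G.Alg ℤ (fun i => M.X i) r m ∈ C.act M} =
      {m : M.X r | ∃ g ∈ GentleData.ppSubgroup ((GentleData.degShift r).map C.compactMap) M,
        m = g.f r (GentleData.GWord.bShift (GentleData.FinWord.triv G v δ) r)} ∧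
    GentleData.ppSubgroup
        (GentleData.toK.map ((GentleData.degShift r).map C.compactMap)) (GentleData.toK.obj M) =
      (GentleData.ppSubgroup ((GentleData.degShift r).map C.compactMap) M).map
        GentleData.toK.mapAddHom := by
  have hval (f : (GentleData.degShift r).obj C.ext.complex ⟶ M) :
      ((GentleData.degShift r).map C.compactMap ≫ f).f r
        (GentleData.GWord.bShift (GentleData.FinWord.triv G v δ) r) = f.f r (C.ext.bShift r) :=
    congrArg (f.f r) (C.compactMap_bShift r)
  refine ⟨Set.ext fun m => ⟨?_, ?_⟩, GentleData.ppSubgroup_map _ _ _⟩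
  · rintro ⟨-, hm⟩
    obtain ⟨f, rfl⟩ := (GentleData.FinWord.mem_act_iff_exists_hom hM).1 hm
    exact ⟨_, ⟨f, rfl⟩, (hval f).symm⟩
  · rintro ⟨_, ⟨f, rfl⟩, hm⟩
    have hact := (GentleData.FinWord.mem_act_iff_exists_hom hM).2 ⟨f, hm.trans (hval f)⟩
    exact ⟨GentleData.e_smul_eq_of_lof_mem_act hact, hact⟩

theorem lemma5 {k V A : Type u} [Field k] [Fintype V] [Fintype A] (G : GentleData k V A)
    (M : CochainComplex (ModuleCat.{u} G.Alg) ℤ) (hM : GentleData.IsMinimalProj M)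
    (v : V) (δ : ℤˣ) (C : G.FinWord v δ) (r : ℤ) :
    {m : M.X r | G.e v • m = m ∧ DirectSum.lof G.Alg ℤ (fun i => M.X i) r m ∈ C.act M} =
      {m : M.X r | ∃ g ∈ GentleData.ppSubgroup ((GentleData.degShift r).map C.compactMap) M,
        m = g.f r (GentleData.GWord.bShift (GentleData.FinWord.triv G v δ) r)} ∧
    GentleData.ppSubgroup
        (GentleData.toK.map ((GentleData.degShift r).map C.compactMap)) (GentleData.toK.obj M) =
      (GentleData.ppSubgroup ((GentleData.degShift r).map C.compactMap) M).map
        GentleData.toK.mapAddHom :=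
  lemma5_general G M hM.isMinimalTorsionless v δ C r
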